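/- Let $\phi\in C_0^\infty(\mathbb R)$ (complex-valued) and let $\mathcal H=(4\pi)^{-1}|D|$, $D=-i\,d/dx$; that is, for $u\in L^1(\mathbb R)$, $\mathcal H u$ is the tempered distribution $(4\pi)^{-1}\mathcal F^{-1}(|\xi|\hat u)$, where $\hat u(\xi)=\int e^{-ix\xi}u(x)\,dx$. Let $h_0$ be the Heaviside function, $x_+=\max(x,0)$, let $x_-^{-1/2}$ be $|x|^{-1/2}$ for $x<0$ and $0$ for $x\ge 0$, and let $\operatorname{pv}\frac1x$ be the distribution $\psi\mapsto\lim_{\varepsilon\to0+}\int_{|x|>\varepsilon}\frac{\psi(x)}{x}\,dx$. Write $S= T \bmod C^0(\mathbb R)$ if $S-T$ is, as a distribution on $\mathbb R$, a continuous function. Then $$\mathcal H(\phi h_0)=\frac1{4\pi^2}\Big(\phi(0)\operatorname{pv}\frac1x+\phi'(0)\log|x|\Big)\quad\bmod C^0(\mathbb R),$$ $$\mathcal H(\phi x_+)=\frac1{4\pi^2}\,\phi(0)\log|x|\quad\bmod C^0(\mathbb R),$$ $$\mathcal H(\phi x_+^{1/2})=-\frac1{8\pi}\,\phi(0)\,x_-^{-1/2}\quad\bmod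 C^0(\mathbb R).$$ -/

import Mathlib

open MeasureTheory Filter Topology Set
open scoped ContDiff SchwartzMap FourierTransform

noncomputable section

namespace SingH

/-! ### Functions as tempered distributions -/

/-- `f` is locally integrable with at most polynomial growth in the mean:
`(1 + |x|)^{-k} f(x)` is integrable on the line for some `k`. -/
def IsTempered (f : ℝ → ℂ) : Prop :=
  ∃ k : ℕ, Integrable (fun x : ℝ => (((1 + ‖x‖) ^ k)⁻¹ : ℝ) • f x)

lemma schwartz_bound (k : ℕ) (ψ : 𝓢(ℝ, ℂ)) (x : ℝ) :
    ‖ψ x‖ ≤ (2 ^ k * ((Finset.Iic (k, 0)).sup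
      (schwartzSeminormFamily ℂ ℝ ℂ)) ψ) * ((1 + ‖x‖) ^ k)⁻¹ := by
  have h := SchwartzMap.one_add_le_sup_seminorm_apply (𝕜 := ℂ) (m := (k, 0)) (k := k) (n := 0)
    le_rfl le_rfl ψ x
  rw [norm_iteratedFDeriv_zero] at h
  rw [← div_eq_mul_inv, le_div_iff₀ (by positivity), mul_comm]
  exact h

lemma mul_bound {f : ℝ → ℂ} (k : ℕ) (ψ : 𝓢(ℝ, ℂ)) (x : ℝ) :
    ‖ψ x * f x‖ ≤ (2 ^ k * ((Finset.Iic (k, 0)).sup (schwartzSeminormFamily ℂ ℝ ℂ)) ψ) *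
      ‖(((1 + ‖x‖) ^ k)⁻¹ : ℝ) • f x‖ := by
  rw [norm_mul, norm_smul, ← mul_assoc]
  refine mul_le_mul_of_nonneg_right ((schwartz_bound k ψ x).trans_eq ?_) (norm_nonneg _)
  rw [Real.norm_of_nonneg (show (0 : ℝ) ≤ ((1 + ‖x‖) ^ k)⁻¹ by positivity)]

lemma IsTempered.aestronglyMeasurable {f : ℝ → ℂ} (hf : IsTempered f) :
    AEStronglyMeasurable f volume := by
  obtain ⟨k, hk⟩ := hf
  have h1 : AEStronglyMeasurable (fun x : ℝ => ((1 + ‖x‖) ^ k : ℝ)) volume := by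
    apply Continuous.aestronglyMeasurable; fun_prop
  refine (h1.smul hk.aestronglyMeasurable).congr (Eventually.of_forall fun x => ?_)
  have : ((1 + ‖x‖) ^ k : ℝ) ≠ 0 := by positivity
  simp only [smul_smul, Pi.smul_apply']
  rw [mul_inv_cancel₀ this, one_smul]

lemma IsTempered.integrable_mul {f : ℝ → ℂ} (hf : IsTempered f) (ψ : 𝓢(ℝ, ℂ)) :
    Integrable (fun x => ψ x * f x) := by
  have hm := hf.aestronglyMeasurable
  obtain ⟨k, hk⟩ := hf
  exact (hk.norm.const_mul _).mono' (ψ.continuous.aestronglyMeasurable.mul hm)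
    (Eventually.of_forall fun x => mul_bound k ψ x)

open Classical in
/-- The tempered distribution `ψ ↦ ∫ ψ f` defined by the function `f`
(and `0` if `f` is not tempered). -/
def ofFun (f : ℝ → ℂ) : 𝓢'(ℝ, ℂ) :=
  if hf : IsTempered f then
    ContinuousLinearMap.toPointwiseConvergenceCLM _ _ _ _ <|
      SchwartzMap.mkCLMtoNormedSpace (σ := RingHom.id ℂ) (fun ψ : 𝓢(ℝ, ℂ) => ∫ x, ψ x * f x)
        (fun ψ χ => by
          rw [← integral_add (hf.integrable_mul ψ) (hf.integrable_mul χ)]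
          simp [add_mul])
        (fun a ψ => by
          simp [mul_assoc, integral_const_mul])
        (by
          obtain ⟨k, hk⟩ := hf
          refine ⟨Finset.Iic (k, 0), 2 ^ k * ∫ x, ‖(((1 + ‖x‖) ^ k)⁻¹ : ℝ) • f x‖,
            by positivity, fun ψ => ?_⟩
          refine (norm_integral_le_of_norm_le (hk.norm.const_mul _)
            (Eventually.of_forall fun x => mul_bound k ψ x)).trans_eq ?_
          rw [integral_const_mul]
          ring)
  else 0

lemma ofFun_apply {f : ℝ → ℂ} (hf : IsTempered f) (ψ : 𝓢(ℝ, ℂ)) :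
    ofFun f ψ = ∫ x, ψ x * f x := by
  rw [ofFun, dif_pos hf]; rfl

lemma isTempered_of_bound {f : ℝ → ℂ} (hm : AEStronglyMeasurable f volume)
    (h0 : IntegrableOn f (Icc (-1) 1)) (C : ℝ) (h1 : ∀ x, 1 < |x| → ‖f x‖ ≤ C * (1 + |x|)) :
    IsTempered f := by
  refine ⟨3, ?_⟩
  have hm' : AEStronglyMeasurable (fun x : ℝ => (((1 + ‖x‖) ^ 3)⁻¹ : ℝ) • f x) volume := by
    have h3 : Continuous fun x : ℝ => (((1 + ‖x‖) ^ 3)⁻¹ : ℝ) :=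
      Continuous.inv₀ (by fun_prop) fun x => by positivity
    exact h3.aestronglyMeasurable.smul hm
  rw [← integrableOn_univ, ← union_compl_self (Icc (-1 : ℝ) 1)]
  refine IntegrableOn.union ?_ ?_
  · refine h0.norm.mono' hm'.restrict (Eventually.of_forall fun x => ?_)
    rw [norm_smul, Real.norm_of_nonneg (by positivity)]
    refine mul_le_of_le_one_left (norm_nonneg _) (inv_le_one_of_one_le₀ ?_)
    exact one_le_pow₀ (by simp)
  · have hi : Integrable (fun x : ℝ => C * (1 + ‖x‖) ^ (-(2 : ℝ))) :=
      (integrable_one_add_norm (by simp)).const_mul C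
    refine hi.integrableOn.mono' hm'.restrict ?_
    refine (ae_restrict_iff' measurableSet_Icc.compl).2 (Eventually.of_forall fun x hx => ?_)
    have hx1 : 1 < |x| := by
      by_contra hc
      exact hx (abs_le.1 (not_lt.1 hc))
    rw [norm_smul, Real.norm_of_nonneg (by positivity)]
    have hp : (0 : ℝ) < 1 + ‖x‖ := by positivity
    rw [Real.rpow_neg hp.le, Real.rpow_ofNat]
    calc ((1 + ‖x‖) ^ 3)⁻¹ * ‖f x‖ ≤ ((1 + ‖x‖) ^ 3)⁻¹ * (C * (1 + ‖x‖)) := by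
          gcongr; exact h1 x hx1
      _ = C * ((1 + ‖x‖) ^ 2)⁻¹ := by field_simp

/-! ### The operator `𝓗 = (4π)⁻¹ |D|` -/

/-- `|D| u` for `u ∈ L¹(ℝ)`: the inverse Fourier transform of the symbol times the Fourier
transform of `u`.  In the normalization `𝓕 u ξ = ∫ e^{-2πixξ} u(x) dx` the operator
`D = -i d/dx` is multiplication by `2πξ`. -/
def absD (u : ℝ → ℂ) : 𝓢'(ℝ, ℂ) :=
  𝓕⁻ (ofFun fun ξ => ((2 * Real.pi * |ξ| : ℝ) : ℂ) * 𝓕 u ξ)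

/-- `𝓗 = (4π)⁻¹ |D|`. -/
def calH (u : ℝ → ℂ) : 𝓢'(ℝ, ℂ) :=
  ((1 / (4 * Real.pi) : ℝ) : ℂ) • absD u

lemma isTempered_absD_symbol {u : ℝ → ℂ} (hu : Integrable u) :
    IsTempered fun ξ => ((2 * Real.pi * |ξ| : ℝ) : ℂ) * 𝓕 u ξ := by
  have hc : Continuous (𝓕 u) :=
    VectorFourier.fourierIntegral_continuous Real.continuous_fourierChar
      (by fun_prop) hu
  have hb : ∀ ξ, ‖𝓕 u ξ‖ ≤ ∫ x, ‖u x‖ := fun ξ =>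
    VectorFourier.norm_fourierIntegral_le_integral_norm _ _ _ _ _
  have hcont : Continuous fun ξ => ((2 * Real.pi * |ξ| : ℝ) : ℂ) * 𝓕 u ξ := by fun_prop
  refine isTempered_of_bound hcont.aestronglyMeasurable
    (hcont.continuousOn.integrableOn_compact isCompact_Icc)
    (2 * Real.pi * ∫ x, ‖u x‖) fun ξ _ => ?_
  rw [norm_mul, Complex.norm_real, Real.norm_of_nonneg (by positivity)]
  have h0 : 0 ≤ ∫ x, ‖u x‖ := by positivity
  calc 2 * Real.pi * |ξ| * ‖𝓕 u ξ‖ ≤ 2 * Real.pi * (1 + |ξ|) * ∫ x, ‖u x‖ := by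
        gcongr
        · linarith
        · exact hb ξ
    _ = _ := by ring

/-- For integrable `u`, `𝓗 u` is given by an absolutely convergent integral. -/
lemma calH_apply {u : ℝ → ℂ} (hu : Integrable u) (ψ : 𝓢(ℝ, ℂ)) :
    calH u ψ = ((1 / (4 * Real.pi) : ℝ) : ℂ) *
      ∫ ξ, (𝓕⁻ ψ) ξ * (((2 * Real.pi * |ξ| : ℝ) : ℂ) * 𝓕 u ξ) := by
  rw [← ofFun_apply (isTempered_absD_symbol hu)]
  rfl

/-! ### The distributions in the expansions -/

/-- The Heaviside function `h₀`. -/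
def heaviside (x : ℝ) : ℝ := if 0 ≤ x then 1 else 0

/-- The distribution `log |x|`. -/
def logAbs : 𝓢'(ℝ, ℂ) := ofFun fun x => ((Real.log |x| : ℝ) : ℂ)

/-- The function `x₋^{-1/2}`: it is `|x|^{-1/2}` for `x < 0` and `0` for `x ≥ 0`. -/
def negPartRpow (x : ℝ) : ℝ := if x < 0 then |x| ^ (-(1 / 2) : ℝ) else 0

/-- The distribution `x₋^{-1/2}`. -/
def negPartInvSqrt : 𝓢'(ℝ, ℂ) := ofFun fun x => ((negPartRpow x : ℝ) : ℂ)

lemma isTempered_logAbs : IsTempered fun x => ((Real.log |x| : ℝ) : ℂ) := by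
  have hm : Measurable fun x : ℝ => Real.log |x| := by fun_prop
  refine isTempered_of_bound (Complex.measurable_ofReal.comp hm).aestronglyMeasurable ?_ 1
    fun x hx => ?_
  · have h : IntervalIntegrable Real.log volume (-1) 1 := intervalIntegral.intervalIntegrable_log'
    rw [intervalIntegrable_iff_integrableOn_Icc_of_le (by norm_num)] at h
    simpa only [Real.log_abs, IntegrableOn] using! Integrable.ofReal (𝕜 := ℂ) h
  · rw [Complex.norm_real, Real.norm_of_nonneg (Real.log_nonneg hx.le)]
    linarith [Real.log_le_sub_one_of_pos (zero_lt_one.trans hx)]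

lemma measurable_negPartRpow : Measurable negPartRpow :=
  Measurable.ite measurableSet_Iio (by fun_prop) measurable_const

lemma isTempered_negPartInvSqrt : IsTempered fun x => ((negPartRpow x : ℝ) : ℂ) := by
  refine isTempered_of_bound
    (Complex.measurable_ofReal.comp measurable_negPartRpow).aestronglyMeasurable ?_ 1
    fun x hx => ?_
  · refine Integrable.ofReal (𝕜 := ℂ) (f := negPartRpow) ?_
    rw [← IntegrableOn]
    have h : IntervalIntegrable (fun x : ℝ => x ^ (-(1 / 2) : ℝ)) volume 0 1 :=
      intervalIntegral.intervalIntegrable_rpow' (by norm_num)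
    have h' := (h.comp_sub_left 0).symm
    simp only [sub_zero, zero_sub] at h'
    rw [intervalIntegrable_iff_integrableOn_Ioo_of_le (by norm_num)] at h'
    have hsplit : Icc (-1 : ℝ) 1 = {-1} ∪ (Ioo (-1) 0 ∪ Icc 0 1) := by
      ext x
      simp only [mem_Icc, mem_union, mem_Ioo, mem_singleton_iff]
      constructor
      · rintro ⟨h1, h2⟩
        rcases eq_or_lt_of_le h1 with h | h
        · exact Or.inl h.symm
        · rcases lt_or_ge x 0 with h3 | h3
          · exact Or.inr (Or.inl ⟨h, h3⟩)
          · exact Or.inr (Or.inr ⟨h3, h2⟩)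
      · rintro (h | ⟨h1, h2⟩ | ⟨h1, h2⟩) <;> constructor <;> linarith
    rw [hsplit]
    refine IntegrableOn.union (by simp) (IntegrableOn.union ?_ ?_)
    · refine h'.congr_fun (fun x hx => ?_) measurableSet_Ioo
      simp only [negPartRpow, if_pos hx.2, abs_of_neg hx.2]
    · refine integrableOn_zero.congr_fun (fun x hx => ?_) measurableSet_Icc
      simp only [negPartRpow, if_neg (not_lt.2 hx.1)]
  · rw [Complex.norm_real, negPartRpow]
    split_ifs
    · rw [Real.norm_of_nonneg (by positivity)]
      have := Real.rpow_le_one_of_one_le_of_nonpos hx.le (show (-(1 / 2) : ℝ) ≤ 0 by norm_num)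
      linarith
    · simp; positivity

/-! ### The principal value -/

/-- The truncated integral `∫_{|x| > ε} ψ(x)/x dx`. -/
def pvTrunc (ψ : ℝ → ℂ) (ε : ℝ) : ℂ := ∫ x in {x : ℝ | ε < |x|}, ψ x / x

/-- `pv ∫ ψ(x)/x dx = lim_{ε → 0+} ∫_{|x| > ε} ψ(x)/x dx`. -/
def pvIntegral (ψ : ℝ → ℂ) : ℂ := limUnder (𝓝[>] (0 : ℝ)) (pvTrunc ψ)

lemma pv_bound (ψ : 𝓢(ℝ, ℂ)) {x : ℝ} (hx : 0 < x) :
    ‖(ψ x - ψ (-x)) / x‖ ≤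
      4 * (SchwartzMap.seminorm ℂ 0 1 ψ + SchwartzMap.seminorm ℂ 1 0 ψ) * (1 + x ^ 2)⁻¹ := by
  have p1 : 0 ≤ SchwartzMap.seminorm ℂ 0 1 ψ := apply_nonneg _ _
  have p2 : 0 ≤ SchwartzMap.seminorm ℂ 1 0 ψ := apply_nonneg _ _
  rw [norm_div, Complex.norm_real, Real.norm_of_nonneg hx.le, div_le_iff₀ hx]
  rw [mul_assoc, ← div_eq_inv_mul, ← mul_div_assoc, le_div_iff₀ (by positivity)]
  rcases le_total x 1 with h | h
  · have hd : ∀ y ∈ (univ : Set ℝ), ‖deriv ψ y‖ ≤ SchwartzMap.seminorm ℂ 0 1 ψ := by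
      intro y _
      have := SchwartzMap.le_seminorm' ℂ 0 1 ψ y
      simpa [iteratedDeriv_one] using this
    have hmv := convex_univ.norm_image_sub_le_of_norm_deriv_le (x := -x) (y := x)
      (fun y _ => ψ.differentiableAt) hd (mem_univ _) (mem_univ _)
    rw [sub_neg_eq_add, Real.norm_of_nonneg (by linarith)] at hmv
    calc ‖ψ x - ψ (-x)‖ * (1 + x ^ 2)
        ≤ (SchwartzMap.seminorm ℂ 0 1 ψ * (x + x)) * 2 := by
          gcongr
          nlinarith
      _ ≤ _ := by nlinarith [mul_nonneg p2 hx.le]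
  · have hd : ∀ y : ℝ, |y| * ‖ψ y‖ ≤ SchwartzMap.seminorm ℂ 1 0 ψ := by
      intro y
      have := SchwartzMap.le_seminorm' ℂ 1 0 ψ y
      simpa using this
    have h1 := hd x
    have h2 := hd (-x)
    rw [abs_neg] at h2
    rw [abs_of_pos hx] at h1 h2
    have h3 : x * ‖ψ x - ψ (-x)‖ ≤ 2 * SchwartzMap.seminorm ℂ 1 0 ψ := by
      have := norm_sub_le (ψ x) (ψ (-x))
      nlinarith
    calc ‖ψ x - ψ (-x)‖ * (1 + x ^ 2)
        ≤ ‖ψ x - ψ (-x)‖ * (2 * x * x) := by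
          gcongr
          nlinarith
      _ = (x * ‖ψ x - ψ (-x)‖) * (2 * x) := by ring
      _ ≤ (2 * SchwartzMap.seminorm ℂ 1 0 ψ) * (2 * x) := by gcongr
      _ ≤ _ := by nlinarith [mul_nonneg p1 hx.le]

lemma aestronglyMeasurable_pv (ψ : 𝓢(ℝ, ℂ)) (s : Set ℝ) :
    AEStronglyMeasurable (fun x : ℝ => (ψ x - ψ (-x)) / x) (volume.restrict s) := by
  have h1 : Measurable ψ := ψ.continuous.measurable
  have h2 : Measurable fun x : ℝ => (ψ x - ψ (-x)) / (x : ℂ) := by fun_prop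
  exact h2.aestronglyMeasurable

lemma integrableOn_pv (ψ : 𝓢(ℝ, ℂ)) :
    IntegrableOn (fun x : ℝ => (ψ x - ψ (-x)) / x) (Ioi 0) := by
  refine (integrable_inv_one_add_sq.const_mul _).integrableOn.mono' (aestronglyMeasurable_pv ψ _)
    ((ae_restrict_iff' measurableSet_Ioi).2 (Eventually.of_forall fun x hx => pv_bound ψ hx))

lemma integrableOn_div (ψ : 𝓢(ℝ, ℂ)) {ε : ℝ} (hε : 0 < ε) :
    IntegrableOn (fun x : ℝ => ψ x / x) {x : ℝ | ε < |x|} := by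
  have hs : MeasurableSet {x : ℝ | ε < |x|} := measurableSet_lt measurable_const (by fun_prop)
  have h1 : Measurable ψ := ψ.continuous.measurable
  have h2 : Measurable fun x : ℝ => ψ x / (x : ℂ) := by fun_prop
  refine (ψ.integrable.norm.const_mul ε⁻¹).integrableOn.mono' h2.aestronglyMeasurable
    ((ae_restrict_iff' hs).2 (Eventually.of_forall fun x hx => ?_))
  rw [norm_div, Complex.norm_real, div_eq_inv_mul, Real.norm_eq_abs]
  gcongr
  exact le_of_lt hx

lemma pvTrunc_eq (ψ : 𝓢(ℝ, ℂ)) {ε : ℝ} (hε : 0 < ε) :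
    pvTrunc ψ ε = ∫ x in Ioi ε, (ψ x - ψ (-x)) / x := by
  have hset : {x : ℝ | ε < |x|} = Ioi ε ∪ Iio (-ε) := by
    ext x
    simp only [mem_ofPred_eq, lt_abs, mem_union, mem_Ioi, mem_Iio]
    constructor
    · rintro (h | h)
      · exact Or.inl h
      · exact Or.inr (by linarith)
    · rintro (h | h)
      · exact Or.inl h
      · exact Or.inr (by linarith)
  have hi := integrableOn_div ψ hε
  rw [hset] at hi
  have hi1 := hi.mono_set subset_union_left
  have hi2 := hi.mono_set subset_union_right
  have hdisj : Disjoint (Ioi ε) (Iio (-ε)) := by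
    rw [Set.disjoint_left]
    intro x h1 h2
    simp only [mem_Ioi, mem_Iio] at h1 h2
    linarith
  have e2 : ∫ x in Iio (-ε), ψ x / x = ∫ x in Ioi ε, ψ (-x) / ((-x : ℝ) : ℂ) := by
    rw [integral_comp_neg_Ioi ε (fun x : ℝ => ψ x / (x : ℂ)), integral_Iic_eq_integral_Iio]
  have hi2' : IntegrableOn (fun x : ℝ => ψ (-x) / ((-x : ℝ) : ℂ)) (Ioi ε) := by
    exact IntegrableOn.comp_neg_Ioi (f := fun x : ℝ => ψ x / (x : ℂ)) hi2
  rw [pvTrunc, hset, setIntegral_union hdisj measurableSet_Iio hi1 hi2, e2,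
    ← integral_add hi1 hi2']
  refine integral_congr_ae (Eventually.of_forall fun x => ?_)
  simp only [Complex.ofReal_neg, div_neg]
  ring

/-- The limit that defines the principal value exists. -/
lemma tendsto_pvTrunc (ψ : 𝓢(ℝ, ℂ)) :
    Tendsto (pvTrunc ψ) (𝓝[>] 0) (𝓝 (∫ x in Ioi (0 : ℝ), (ψ x - ψ (-x)) / x)) := by
  have key : Tendsto (fun ε : ℝ => ∫ x in Ioi (0 : ℝ),
      (Ioi ε).indicator (fun x : ℝ => (ψ x - ψ (-x)) / (x : ℂ)) x) (𝓝[>] 0)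
      (𝓝 (∫ x in Ioi (0 : ℝ), (ψ x - ψ (-x)) / x)) := by
    refine tendsto_integral_filter_of_dominated_convergence
      (fun x => ‖(ψ x - ψ (-x)) / (x : ℂ)‖) ?_ ?_ (integrableOn_pv ψ).norm ?_
    · exact Eventually.of_forall fun ε =>
        (aestronglyMeasurable_pv ψ _).indicator measurableSet_Ioi
    · exact Eventually.of_forall fun ε => Eventually.of_forall fun x => norm_indicator_le_norm_self _ _
    · refine (ae_restrict_iff' measurableSet_Ioi).2 (Eventually.of_forall fun x hx => ?_)
      refine tendsto_const_nhds.congr' ?_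
      have : ∀ᶠ ε in 𝓝[>] (0 : ℝ), ε < x := nhdsWithin_le_nhds (Iio_mem_nhds hx)
      filter_upwards [this] with ε hε
      rw [indicator_of_mem (show x ∈ Ioi ε from hε)]
  refine key.congr' ?_
  filter_upwards [self_mem_nhdsWithin] with ε hε
  have hε' : (0 : ℝ) < ε := hε
  rw [pvTrunc_eq ψ hε', setIntegral_indicator measurableSet_Ioi,
    inter_eq_self_of_subset_right (Ioi_subset_Ioi hε'.le)]

lemma pvIntegral_eq (ψ : 𝓢(ℝ, ℂ)) :
    pvIntegral ψ = ∫ x in Ioi (0 : ℝ), (ψ x - ψ (-x)) / x :=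
  (tendsto_pvTrunc ψ).limUnder_eq

/-- The distribution `pv (1/x)`. -/
def pvInv : 𝓢'(ℝ, ℂ) :=
  ContinuousLinearMap.toPointwiseConvergenceCLM _ _ _ _ <|
    SchwartzMap.mkCLMtoNormedSpace (σ := RingHom.id ℂ) (fun ψ : 𝓢(ℝ, ℂ) => pvIntegral ψ)
      (fun ψ χ => by
        rw [pvIntegral_eq, pvIntegral_eq, pvIntegral_eq,
          ← integral_add (integrableOn_pv ψ) (integrableOn_pv χ)]
        refine integral_congr_ae (Eventually.of_forall fun x => ?_)
        simp only [add_apply]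
        ring)
      (fun a ψ => by
        rw [pvIntegral_eq, pvIntegral_eq, RingHom.id_apply, smul_eq_mul, ← integral_const_mul]
        refine integral_congr_ae (Eventually.of_forall fun x => ?_)
        simp only [smul_apply, smul_eq_mul]
        ring)
      (by
        refine ⟨{(0, 1), (1, 0)}, 8 * ∫ x in Ioi (0 : ℝ), (1 + x ^ 2)⁻¹, ?_, fun ψ => ?_⟩
        · have : 0 ≤ ∫ x in Ioi (0 : ℝ), (1 + x ^ 2)⁻¹ :=
            integral_nonneg fun x => by positivity
          positivity
        · rw [pvIntegral_eq]
          have h := norm_integral_le_of_norm_le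
            (integrable_inv_one_add_sq.const_mul
              (4 * (SchwartzMap.seminorm ℂ 0 1 ψ + SchwartzMap.seminorm ℂ 1 0 ψ))).integrableOn
            ((ae_restrict_iff' (μ := volume) (measurableSet_Ioi (a := (0 : ℝ)))).2
              (Eventually.of_forall fun x hx => pv_bound ψ hx))
          rw [integral_const_mul] at h
          refine h.trans ?_
          have hI : 0 ≤ ∫ x in Ioi (0 : ℝ), (1 + x ^ 2)⁻¹ :=
            integral_nonneg fun x => by positivity
          have s1 : SchwartzMap.seminorm ℂ 0 1 ψ ≤
              (({(0, 1), (1, 0)} : Finset (ℕ × ℕ)).sup (schwartzSeminormFamily ℂ ℝ ℂ)) ψ :=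
            Seminorm.le_def.1 (Finset.le_sup (f := schwartzSeminormFamily ℂ ℝ ℂ)
              (b := (0, 1)) (by simp)) ψ
          have s2 : SchwartzMap.seminorm ℂ 1 0 ψ ≤
              (({(0, 1), (1, 0)} : Finset (ℕ × ℕ)).sup (schwartzSeminormFamily ℂ ℝ ℂ)) ψ :=
            Seminorm.le_def.1 (Finset.le_sup (f := schwartzSeminormFamily ℂ ℝ ℂ)
              (b := (1, 0)) (by simp)) ψ
          nlinarith)

lemma pvInv_apply (ψ : 𝓢(ℝ, ℂ)) : pvInv ψ = pvIntegral ψ := rfl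

/-! ### Equality modulo continuous functions -/

/-- `S = T mod C⁰(ℝ)`: on the line, in the sense of distributions (that is, on all smooth test
functions of compact support), `S - T` is a continuous function. -/
def EqModC0 (S T : 𝓢'(ℝ, ℂ)) : Prop :=
  ∃ g : ℝ → ℂ, Continuous g ∧
    ∀ ψ : 𝓢(ℝ, ℂ), HasCompactSupport ψ → S ψ - T ψ = ∫ x, ψ x * g x

/-- The functions to which `𝓗` is applied are integrable. -/
lemma integrable_cutoff {φ : ℝ → ℂ} (hφ : Continuous φ) (hc : HasCompactSupport φ) {f : ℝ → ℝ}
    (hf : LocallyIntegrable f) : Integrable fun x => φ x * f x :=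
  (LocallyIntegrable.integrable_smul_left_of_hasCompactSupport
    (f := fun x => ((f x : ℝ) : ℂ)) (fun x => (hf x).imp fun _ h => ⟨h.1, h.2.ofReal⟩) hφ hc)

lemma locallyIntegrable_heaviside : LocallyIntegrable heaviside := by
  refine (locallyIntegrable_const (1 : ℝ)).mono ?_ (Eventually.of_forall fun x => ?_)
  · exact (Measurable.ite measurableSet_Ici measurable_const
      measurable_const).aestronglyMeasurable
  · rw [heaviside]; split_ifs <;> simp

lemma locallyIntegrable_posPart : LocallyIntegrable fun x : ℝ => max x 0 :=
  Continuous.locallyIntegrable (by fun_prop)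

lemma locallyIntegrable_posPart_sqrt :
    LocallyIntegrable fun x : ℝ => (max x 0) ^ (1 / 2 : ℝ) :=
  Continuous.locallyIntegrable
    ((continuous_id.max continuous_const).rpow_const fun _ => Or.inr (by norm_num))

end SingH

end

namespace SingH

/-! ### The integral `∫₀^∞ (1 - cos (a t)) / t² dt` -/

/-! The integral of (1 - cos(at))/t² over t > 0 is (π/2)|a|. Taking a = 2πξ turns the symbol of |D|
into an integral of symbols of second differences, so 4π² 𝓗u = ∫₀^∞ t⁻² (2u(x) - u(x+t) - u(x-t))
dt, where the average in x against a test function ψ is taken before the integral in t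
(`hasPairing_calH`).

This right-hand side is linear in u and does not require u to be integrable on the line. The cutoff
φ can therefore be removed from the leading terms, leaving three model computations. For h₀, the
average against ψ is the integral of ψ(s) - ψ(-s) over 0 < s < t, and Fubini gives pv(1/x)
(`hasPairing_heaviside`). For x₊, the second difference is -(t - |x|)₊, and integrating it over 0 <
t ≤ 1 gives log|x| plus a continuous function (`hasPairing_posPart`). For x₊^{1/2}, homogeneity
makes the integral c|x|^{-1/2}, with c depending only on the sign of x. Explicit primitives at x =
±1 give c = -π/2 on the left and c = 0 on the right (`hasPairing_sqrt`).

Whatever is left has second differences that, divided by t², are integrable in t with a bound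
locally uniform in x, so it contributes a continuous function (`exists_continuous_hasPairing`). The
decompositions are φh₀ = φ(0)h₀ + f(x₊) with f = φ - φ(0), φx₊ = f(x₊) with f(x) = xφ(x), and
φx₊^{1/2} = φ(0)x₊^{1/2} + (φ - φ(0))x₊^{1/2}. A function f(x₊) contributes f'(0) log|x|
(`exists_hasPairing_comp_posPart`), while the last remainder is harmless because φ - φ(0) vanishes
at 0 (`exists_hasPairing_mul_sqrt`). -/

lemma tendsto_exp_neg_mul_atTop {s : ℝ} (hs : 0 < s) :
    Tendsto (fun t : ℝ => Real.exp (-(t * s))) atTop (𝓝 0) :=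
  Real.tendsto_exp_neg_atTop_nhds_zero.comp (tendsto_id.atTop_mul_const hs)

/-- Laplace representation of t⁻²; it replaces the kernel by exponentials so that the t-integral
becomes elementary. -/
lemma integral_mul_exp_neg_mul_Ioi {t : ℝ} (ht : 0 < t) :
    IntegrableOn (fun s : ℝ => s * Real.exp (-(t * s))) (Ioi 0) ∧
      ∫ s in Ioi (0 : ℝ), s * Real.exp (-(t * s)) = 1 / t ^ 2 := by
  have hd : ∀ s ∈ Ici (0 : ℝ), HasDerivAt
      (fun s : ℝ => -(s / t + 1 / t ^ 2) * Real.exp (-(t * s))) (s * Real.exp (-(t * s))) s := by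
    intro s _
    have h1 : HasDerivAt (fun s : ℝ => -(s / t + 1 / t ^ 2)) (-(1 / t)) s :=
      (((hasDerivAt_id s).div_const t).add_const _).neg
    have h2 : HasDerivAt (fun s : ℝ => Real.exp (-(t * s))) (Real.exp (-(t * s)) * -(t * 1)) s :=
      (((hasDerivAt_id s).const_mul t).neg).exp
    refine (h1.mul h2).congr_deriv ?_
    field_simp
    ring
  have hlim : Tendsto (fun s : ℝ => -(s / t + 1 / t ^ 2) * Real.exp (-(t * s))) atTop (𝓝 0) := by
    have h1 : Tendsto (fun s : ℝ => (t * s) * Real.exp (-(t * s))) atTop (𝓝 0) := by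
      have := (Real.tendsto_pow_mul_exp_neg_atTop_nhds_zero 1).comp
        (tendsto_id.const_mul_atTop ht)
      simpa [Function.comp_def] using this
    have h2 : Tendsto (fun s : ℝ => Real.exp (-(t * s))) atTop (𝓝 0) :=
      Real.tendsto_exp_neg_atTop_nhds_zero.comp (tendsto_id.const_mul_atTop ht)
    have h3 := ((h1.add h2).const_mul (-(1 / t ^ 2)))
    simp only [add_zero, mul_zero] at h3
    refine h3.congr fun s => ?_
    field_simp
  have hn : ∀ s ∈ Ioi (0 : ℝ), 0 ≤ s * Real.exp (-(t * s)) := fun s hs =>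
    mul_nonneg (le_of_lt hs) (Real.exp_nonneg _)
  refine ⟨integrableOn_Ioi_deriv_of_nonneg' hd hn hlim, ?_⟩
  rw [integral_Ioi_of_hasDerivAt_of_nonneg' hd hn hlim]
  simp

/-- This is s times the Laplace transform of 1 - cos, namely s(1/s - s/(1 + s²)). -/
lemma integral_one_sub_cos_mul_exp_neg_mul_Ioi {s : ℝ} (hs : 0 < s) :
    IntegrableOn (fun t : ℝ => (1 - Real.cos t) * (s * Real.exp (-(t * s)))) (Ioi 0) ∧
      ∫ t in Ioi (0 : ℝ), (1 - Real.cos t) * (s * Real.exp (-(t * s))) = (1 + s ^ 2)⁻¹ := by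
  have hs2 : (1 + s ^ 2) ≠ 0 := by positivity
  have hd : ∀ t ∈ Ici (0 : ℝ), HasDerivAt
      (fun t : ℝ => Real.exp (-(t * s)) * (-1 - s / (1 + s ^ 2) * (Real.sin t - s * Real.cos t)))
      ((1 - Real.cos t) * (s * Real.exp (-(t * s)))) t := by
    intro t _
    have h1 : HasDerivAt (fun t : ℝ => Real.exp (-(t * s))) (Real.exp (-(t * s)) * -(1 * s)) t :=
      (((hasDerivAt_id t).mul_const s).neg).exp
    have h2 : HasDerivAt (fun t : ℝ => -1 - s / (1 + s ^ 2) * (Real.sin t - s * Real.cos t))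
        (-(s / (1 + s ^ 2) * (Real.cos t - s * -Real.sin t))) t :=
      (((Real.hasDerivAt_sin t).sub ((Real.hasDerivAt_cos t).const_mul s)).const_mul _).const_sub _
    refine (h1.mul h2).congr_deriv ?_
    field_simp
    ring
  have hlim : Tendsto (fun t : ℝ => Real.exp (-(t * s)) *
      (-1 - s / (1 + s ^ 2) * (Real.sin t - s * Real.cos t))) atTop (𝓝 0) := by
    refine (tendsto_exp_neg_mul_atTop hs).zero_mul_isBoundedUnder_le ?_
    refine isBoundedUnder_of ⟨1 + s / (1 + s ^ 2) * (1 + s), fun t => ?_⟩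
    simp only [Function.comp, Real.norm_eq_abs]
    have h1 := Real.abs_sin_le_one t
    have h2 := Real.abs_cos_le_one t
    have h3 : |Real.sin t - s * Real.cos t| ≤ 1 + s := by
      refine (abs_sub _ _).trans ?_
      rw [abs_mul, abs_of_pos hs]
      nlinarith
    refine (abs_sub _ _).trans ?_
    rw [abs_mul, abs_of_pos (show 0 < s / (1 + s ^ 2) by positivity), abs_neg, abs_one]
    gcongr
  have hn : ∀ t ∈ Ioi (0 : ℝ), 0 ≤ (1 - Real.cos t) * (s * Real.exp (-(t * s))) := fun t _ =>
    mul_nonneg (by linarith [Real.cos_le_one t]) (by positivity)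
  refine ⟨integrableOn_Ioi_deriv_of_nonneg' hd hn hlim, ?_⟩
  rw [integral_Ioi_of_hasDerivAt_of_nonneg' hd hn hlim]
  simp only [zero_mul, neg_zero, Real.exp_zero, Real.sin_zero, Real.cos_zero]
  field_simp
  ring

/-- Write t⁻² as a Laplace integral and exchange the order. The integrand is nonnegative, so
absolute convergence comes with the value, the arctangent integral of 1/(1 + s²). -/
lemma integral_one_sub_cos_div_sq_Ioi :
    IntegrableOn (fun t : ℝ => (1 - Real.cos t) / t ^ 2) (Ioi 0) ∧
      ∫ t in Ioi (0 : ℝ), (1 - Real.cos t) / t ^ 2 = Real.pi / 2 := by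
  set μ := volume.restrict (Ioi (0 : ℝ))
  set F : ℝ → ℝ → ℝ := fun s t => (1 - Real.cos t) * (s * Real.exp (-(t * s)))
  have hF : Integrable (Function.uncurry F) (μ.prod μ) := by
    rw [integrable_prod_iff (by
      apply Continuous.aestronglyMeasurable
      simp only [F, Function.uncurry_def]
      fun_prop)]
    refine ⟨(ae_restrict_iff' measurableSet_Ioi).2 (Eventually.of_forall fun s hs =>
      (integral_one_sub_cos_mul_exp_neg_mul_Ioi hs).1), ?_⟩
    refine (integrable_inv_one_add_sq.integrableOn (s := Ioi 0)).congr ?_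
    refine (ae_restrict_iff' measurableSet_Ioi).2 (Eventually.of_forall fun s hs => ?_)
    simp only [Function.uncurry_apply_pair]
    rw [← (integral_one_sub_cos_mul_exp_neg_mul_Ioi hs).2]
    refine integral_congr_ae (Eventually.of_forall fun t => ?_)
    simp only [F]
    rw [Real.norm_of_nonneg]
    exact mul_nonneg (by linarith [Real.cos_le_one t])
      (mul_nonneg (le_of_lt hs) (Real.exp_nonneg _))
  have hin : ∀ t ∈ Ioi (0 : ℝ), ∫ s, F s t ∂μ = (1 - Real.cos t) / t ^ 2 := by
    intro t ht
    simp only [F]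
    rw [integral_const_mul, (integral_mul_exp_neg_mul_Ioi ht).2]
    ring
  have hae : (fun t => ∫ s, F s t ∂μ) =ᵐ[μ] fun t => (1 - Real.cos t) / t ^ 2 :=
    (ae_restrict_iff' measurableSet_Ioi).2 (Eventually.of_forall hin)
  refine ⟨hF.integral_prod_right.congr hae, ?_⟩
  rw [← integral_congr_ae hae, ← integral_integral_swap hF]
  have : ∫ s in Ioi (0 : ℝ), (1 + s ^ 2)⁻¹ = Real.pi / 2 := by
    rw [integral_Ioi_inv_one_add_sq, Real.arctan_zero, sub_zero]
  rw [← this]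
  exact setIntegral_congr_fun measurableSet_Ioi fun s hs =>
    (integral_one_sub_cos_mul_exp_neg_mul_Ioi hs).2

lemma integral_one_sub_cos_mul_div_sq_Ioi (a : ℝ) :
    IntegrableOn (fun t : ℝ => (1 - Real.cos (a * t)) / t ^ 2) (Ioi 0) ∧
      ∫ t in Ioi (0 : ℝ), (1 - Real.cos (a * t)) / t ^ 2 = Real.pi / 2 * |a| := by
  rcases eq_or_ne a 0 with rfl | ha
  · simp
  have h0 : 0 < |a| := abs_pos.2 ha
  have he : (fun t : ℝ => (1 - Real.cos (a * t)) / t ^ 2) =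
      fun t => |a| ^ 2 * ((1 - Real.cos (|a| * t)) / (|a| * t) ^ 2) := by
    funext t
    have hc : Real.cos (|a| * t) = Real.cos (a * t) := by
      rcases abs_choice a with h | h <;> rw [h]
      rw [neg_mul, Real.cos_neg]
    rw [hc, mul_pow]
    field_simp
  obtain ⟨h1, h2⟩ := integral_one_sub_cos_div_sq_Ioi
  rw [he]
  constructor
  · refine Integrable.const_mul ?_ _
    have := (integrableOn_Ioi_comp_mul_left_iff
      (fun t : ℝ => (1 - Real.cos t) / t ^ 2) 0 h0).2 (by simpa using h1)
    exact this
  · rw [integral_const_mul, integral_comp_mul_left_Ioi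
      (fun t : ℝ => (1 - Real.cos t) / t ^ 2) 0 h0, mul_zero, h2, smul_eq_mul]
    field_simp

/-! ### `|D|` as a singular integral of second differences -/

/-- The symmetric second difference `2 v(x) - v(x + t) - v(x - t)`. -/
def secondDiff (v : ℝ → ℂ) (t x : ℝ) : ℂ := 2 * v x - v (x + t) - v (x - t)

/-- The weighted average `t⁻² ∫ ψ(x) (2 v(x) - v(x + t) - v(x - t)) dx`. -/
noncomputable def pairing (v ψ : ℝ → ℂ) (t : ℝ) : ℂ := (∫ x, ψ x * secondDiff v t x) / (t : ℂ) ^ 2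

/-- The integral over `T` of the weighted averages of the second differences of `v` against `ψ`
converges absolutely, and its value is `I`. -/
structure HasPairing (T : Set ℝ) (v ψ : ℝ → ℂ) (I : ℂ) : Prop where
  integrableOn : IntegrableOn (pairing v ψ) T
  integral_eq : ∫ t in T, pairing v ψ t = I

lemma fourier_comp_add (u : ℝ → ℂ) (t ξ : ℝ) :
    𝓕 (fun x => u (x + t)) ξ = Complex.exp ((2 * Real.pi * (ξ * t) : ℝ) * Complex.I) * 𝓕 u ξ := by
  have h := congrFun (VectorFourier.fourierIntegral_comp_add_right Real.fourierChar volume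
    (innerₗ ℝ) u t) ξ
  have h2 : 𝓕 (fun x => u (x + t)) ξ = Real.fourierChar ((innerₗ ℝ) t ξ) • 𝓕 u ξ := h
  rw [h2, Circle.smul_def, Real.fourierChar_apply, smul_eq_mul]
  rfl

lemma integrable_secondDiff {u : ℝ → ℂ} (hu : Integrable u) (t : ℝ) :
    Integrable (secondDiff u t) :=
  ((hu.const_mul 2).sub (hu.comp_add_right t)).sub (hu.comp_sub_right t)

lemma fourier_secondDiff {u : ℝ → ℂ} (hu : Integrable u) (t ξ : ℝ) :
    𝓕 (secondDiff u t) ξ = ((2 * (1 - Real.cos (2 * Real.pi * ξ * t)) : ℝ) : ℂ) * 𝓕 u ξ := by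
  have e1 := fourier_comp_add u t ξ
  have e2 := fourier_comp_add u (-t) ξ
  have h1 : 𝓕 (secondDiff u t) ξ =
      2 * 𝓕 u ξ - 𝓕 (fun x => u (x + t)) ξ - 𝓕 (fun x => u (x + -t)) ξ := by
    have hi : ∀ {w : ℝ → ℂ}, Integrable w →
        Integrable fun x => Real.fourierChar (-(x * ξ)) • w x := fun hw => by
      have := (Real.fourierIntegral_convergent_iff (V := ℝ) ξ).2 hw
      simpa [mul_comm] using this
    simp only [Real.fourier_real_eq, secondDiff, smul_sub]
    rw [integral_sub, integral_sub]
    · congr 2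
      rw [← integral_const_mul]
      refine integral_congr_ae (Eventually.of_forall fun x => ?_)
      simp only [Circle.smul_def, smul_eq_mul]
      ring
    · exact hi (hu.const_mul 2)
    · exact hi (hu.comp_add_right t)
    · exact (hi (hu.const_mul 2)).sub (hi (hu.comp_add_right t))
    · exact hi (hu.comp_sub_right t)
  rw [h1, e1, e2]
  have hc : Complex.exp ((2 * Real.pi * (ξ * t) : ℝ) * Complex.I) +
      Complex.exp ((2 * Real.pi * (ξ * -t) : ℝ) * Complex.I) =
      2 * ((Real.cos (2 * Real.pi * ξ * t) : ℝ) : ℂ) := by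
    rw [Complex.ofReal_cos, Complex.two_cos]
    congr 2 <;> push_cast <;> ring
  have : ((2 * (1 - Real.cos (2 * Real.pi * ξ * t)) : ℝ) : ℂ) =
      2 - 2 * ((Real.cos (2 * Real.pi * ξ * t) : ℝ) : ℂ) := by
    push_cast; ring
  rw [this, ← hc]
  ring

/-- The Fourier transform can be moved from one factor to the other, and it undoes 𝓕⁻ on ψ. -/
lemma integral_fourierInv_mul_fourier (ψ : 𝓢(ℝ, ℂ)) {g : ℝ → ℂ} (hg : Integrable g) :
    ∫ ξ, (𝓕⁻ ψ) ξ * 𝓕 g ξ = ∫ x, ψ x * g x := by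
  have h := VectorFourier.integral_fourierIntegral_smul_eq_flip (L := innerₗ ℝ) (μ := volume)
    (ν := volume) Real.continuous_fourierChar (by simpa using! continuous_inner)
    (𝓕⁻ ψ).integrable hg
  have h1 : VectorFourier.fourierIntegral Real.fourierChar volume (innerₗ ℝ) (𝓕⁻ ψ : 𝓢(ℝ, ℂ)) =
      (ψ : ℝ → ℂ) := by
    conv_rhs => rw [← FourierInvPair.fourier_fourierInv_eq (F := 𝓢(ℝ, ℂ)) ψ, SchwartzMap.fourier_coe]
    rfl
  rw [h1, flip_innerₗ] at h
  exact h.symm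

/-- The operator `𝓗` as a singular integral of second differences. -/
lemma hasPairing_calH {u : ℝ → ℂ} (hu : Integrable u) (ψ : 𝓢(ℝ, ℂ)) :
    HasPairing (Ioi 0) u ψ (((4 * Real.pi ^ 2 : ℝ) : ℂ) * calH u ψ) := by
  set μ := volume.restrict (Ioi (0 : ℝ))
  set A : ℝ → ℂ := fun ξ => (𝓕⁻ ψ) ξ * 𝓕 u ξ
  set F : ℝ → ℝ → ℂ := fun ξ t =>
    A ξ * ((2 * ((1 - Real.cos (2 * Real.pi * ξ * t)) / t ^ 2) : ℝ) : ℂ)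
  have hA : Continuous A := (𝓕⁻ ψ).continuous.mul
    (VectorFourier.fourierIntegral_continuous Real.continuous_fourierChar (by fun_prop) hu)
  have hint := (isTempered_absD_symbol hu).integrable_mul (𝓕⁻ ψ)
  have hk : ∀ ξ, IntegrableOn
      (fun t : ℝ => 2 * ((1 - Real.cos (2 * Real.pi * ξ * t)) / t ^ 2)) (Ioi 0) := fun ξ =>
    (integral_one_sub_cos_mul_div_sq_Ioi (2 * Real.pi * ξ)).1.const_mul 2
  have hkv : ∀ ξ, ∫ t in Ioi (0 : ℝ), 2 * ((1 - Real.cos (2 * Real.pi * ξ * t)) / t ^ 2) =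
      Real.pi * (2 * Real.pi * |ξ|) := fun ξ => by
    rw [integral_const_mul, (integral_one_sub_cos_mul_div_sq_Ioi (2 * Real.pi * ξ)).2, abs_mul,
      abs_of_pos Real.two_pi_pos]
    ring
  have hm : AEStronglyMeasurable (Function.uncurry F) (volume.prod μ) := by
    have h1 : Measurable fun p : ℝ × ℝ => A p.1 := hA.measurable.comp measurable_fst
    have h2 : Measurable fun p : ℝ × ℝ =>
        2 * ((1 - Real.cos (2 * Real.pi * p.1 * p.2)) / p.2 ^ 2) := by fun_prop
    exact (h1.mul (Complex.measurable_ofReal.comp h2)).aestronglyMeasurable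
  -- The kernel in t is nonnegative, so integrating its norm reproduces π times the symbol of |D|.
  -- Joint integrability is thus the absolute convergence in `calH_apply`.
  have hF : Integrable (Function.uncurry F) (volume.prod μ) := by
    rw [integrable_prod_iff hm]
    refine ⟨Eventually.of_forall fun ξ => ((hk ξ).ofReal (𝕜 := ℂ)).const_mul (A ξ), ?_⟩
    refine (hint.norm.const_mul Real.pi).congr (Eventually.of_forall fun ξ => ?_)
    simp only [Function.uncurry_apply_pair, F, norm_mul (A ξ)]
    rw [integral_const_mul]
    have : ∀ t : ℝ, ‖((2 * ((1 - Real.cos (2 * Real.pi * ξ * t)) / t ^ 2) : ℝ) : ℂ)‖ =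
        2 * ((1 - Real.cos (2 * Real.pi * ξ * t)) / t ^ 2) := fun t => by
      rw [Complex.norm_real, Real.norm_of_nonneg]
      have := Real.cos_le_one (2 * Real.pi * ξ * t)
      exact mul_nonneg zero_le_two (div_nonneg (by linarith) (sq_nonneg t))
    simp only [this]
    rw [hkv, norm_mul, norm_mul, norm_mul, Complex.norm_real, Real.norm_of_nonneg (by positivity)]
    ring
  have hl : ∀ ξ, ∫ t, F ξ t ∂μ =
      Real.pi * ((𝓕⁻ ψ) ξ * (((2 * Real.pi * |ξ| : ℝ) : ℂ) * 𝓕 u ξ)) := fun ξ => by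
    simp only [F]
    rw [integral_const_mul, integral_complex_ofReal, hkv]
    simp only [A]
    push_cast
    ring
  have hr : ∀ t, ∫ ξ, F ξ t = pairing u ψ t := fun t => by
    rw [pairing, ← integral_fourierInv_mul_fourier ψ (integrable_secondDiff hu t),
      ← integral_div]
    refine integral_congr_ae (Eventually.of_forall fun ξ => ?_)
    simp only [F, A, fourier_secondDiff hu]
    push_cast
    ring
  have hr' : (fun t => ∫ ξ, F ξ t) = pairing u ψ := funext hr
  refine ⟨?_, ?_⟩
  · rw [← hr']
    exact hF.integral_prod_right
  · rw [← hr', ← integral_integral_swap hF]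
    simp only [hl]
    rw [integral_const_mul, calH_apply hu, ← mul_assoc, ← Complex.ofReal_mul]
    congr 2
    field_simp

/-! ### Rules for the pairings -/

lemma locallyIntegrable_comp_add_right {v : ℝ → ℂ} (hv : LocallyIntegrable v) (t : ℝ) :
    LocallyIntegrable fun x => v (x + t) := by
  have h := (locallyIntegrable_map_homeomorph (Homeomorph.addRight t) (f := v) (μ := volume)).1
  rw [Homeomorph.coe_addRight, map_add_right_eq_self] at h
  exact h hv

lemma locallyIntegrable_secondDiff {v : ℝ → ℂ} (hv : LocallyIntegrable v) (t : ℝ) :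
    LocallyIntegrable (secondDiff v t) := by
  have h1 : LocallyIntegrable fun x => 2 * v x := hv.smul (2 : ℂ)
  have h2 := locallyIntegrable_comp_add_right hv t
  have h3 : LocallyIntegrable fun x => v (x - t) := by
    simpa only [sub_eq_add_neg] using locallyIntegrable_comp_add_right hv (-t)
  exact (h1.sub h2).sub h3

lemma integrable_mul_secondDiff {v ψ : ℝ → ℂ} (hv : LocallyIntegrable v) (hψ : Continuous ψ)
    (hc : HasCompactSupport ψ) (t : ℝ) : Integrable fun x => ψ x * secondDiff v t x :=
  (locallyIntegrable_secondDiff hv t).integrable_smul_left_of_hasCompactSupport hψ hc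

namespace HasPairing

variable {T T' : Set ℝ} {v w ψ : ℝ → ℂ} {I J : ℂ}

lemma add (hv : LocallyIntegrable v) (hw : LocallyIntegrable w) (hψ : Continuous ψ)
    (hc : HasCompactSupport ψ) (h1 : HasPairing T v ψ I) (h2 : HasPairing T w ψ J) :
    HasPairing T (fun x => v x + w x) ψ (I + J) := by
  have : pairing (fun x => v x + w x) ψ = fun t => pairing v ψ t + pairing w ψ t := by
    funext t
    simp only [pairing]
    rw [← add_div, ← integral_add (integrable_mul_secondDiff hv hψ hc t)
      (integrable_mul_secondDiff hw hψ hc t)]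
    congr 2
    funext x
    simp only [secondDiff]
    ring
  refine ⟨?_, ?_⟩
  · rw [this]
    exact Integrable.add h1.integrableOn h2.integrableOn
  · rw [this, integral_add h1.integrableOn h2.integrableOn, h1.integral_eq, h2.integral_eq]

lemma const_mul (c : ℂ) (h : HasPairing T v ψ I) :
    HasPairing T (fun x => c * v x) ψ (c * I) := by
  have : pairing (fun x => c * v x) ψ = fun t => c * pairing v ψ t := by
    funext t
    simp only [pairing]
    rw [← mul_div_assoc, ← integral_const_mul]
    congr 2
    funext x
    simp only [secondDiff]
    ring
  refine ⟨?_, ?_⟩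
  · rw [this]
    exact Integrable.const_mul h.integrableOn c
  · rw [this, integral_const_mul, h.integral_eq]

lemma union (hd : Disjoint T T') (hT' : MeasurableSet T') (h1 : HasPairing T v ψ I)
    (h2 : HasPairing T' v ψ J) : HasPairing (T ∪ T') v ψ (I + J) :=
  ⟨h1.integrableOn.union h2.integrableOn, by
    rw [setIntegral_union hd hT' h1.integrableOn h2.integrableOn, h1.integral_eq, h2.integral_eq]⟩

end HasPairing

/-! ### Exchanging the integrals in x and t. -/

lemma measurable_secondDiff_div {v : ℝ → ℂ} (hv : Measurable v) :
    Measurable fun p : ℝ × ℝ => secondDiff v p.2 p.1 / (p.2 : ℂ) ^ 2 := by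
  simp only [secondDiff]
  fun_prop

/-- Fubini's theorem for the pairing. -/
lemma hasPairing_of_integral_norm_le {T : Set ℝ} {v ψ : ℝ → ℂ}
    (hv : Measurable v) (hψ : Continuous ψ) (hc : HasCompactSupport ψ) {K : ℝ → ℝ}
    (hK : LocallyIntegrable K)
    (hi : ∀ᵐ x, IntegrableOn (fun t : ℝ => secondDiff v t x / (t : ℂ) ^ 2) T)
    (hb : ∀ᵐ x, ∫ t in T, ‖secondDiff v t x / (t : ℂ) ^ 2‖ ≤ K x) :
    HasPairing T v ψ (∫ x, ψ x * ∫ t in T, secondDiff v t x / (t : ℂ) ^ 2) := by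
  set μ := volume.restrict T
  set F : ℝ → ℝ → ℂ := fun x t => ψ x * (secondDiff v t x / (t : ℂ) ^ 2)
  have hm : AEStronglyMeasurable (Function.uncurry F) (volume.prod μ) :=
    ((hψ.measurable.comp measurable_fst).mul (measurable_secondDiff_div hv)).aestronglyMeasurable
  have hF : Integrable (Function.uncurry F) (volume.prod μ) := by
    rw [integrable_prod_iff hm]
    refine ⟨hi.mono fun x hx => hx.const_mul (ψ x), ?_⟩
    have hKi : Integrable fun x => ‖ψ x‖ * K x :=
      hK.integrable_smul_left_of_hasCompactSupport hψ.norm hc.norm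
    refine hKi.mono' hm.norm.integral_prod_right' (hb.mono fun x hx => ?_)
    simp only [Function.uncurry_apply_pair, F, norm_mul]
    rw [integral_const_mul, Real.norm_of_nonneg (by positivity)]
    gcongr
  have hr : (fun t => ∫ x, F x t) = pairing v ψ := by
    funext t
    simp only [F, pairing, ← mul_div_assoc]
    rw [integral_div]
  refine ⟨?_, ?_⟩
  · rw [← hr]
    exact hF.integral_prod_right
  · rw [← hr, ← integral_integral_swap hF]
    simp only [F]
    congr 1
    funext x
    rw [integral_const_mul]

/-- If the second differences of the continuous function `v` are dominated, locally uniformly in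
`x`, then the pairing is integration against a continuous function. -/
lemma exists_continuous_hasPairing {T : Set ℝ} (hT : MeasurableSet T) {v : ℝ → ℂ}
    (hv : Continuous v)
    (hb : ∀ R : ℝ, ∃ B : ℝ → ℝ, IntegrableOn B T ∧
      ∀ x, |x| ≤ R → ∀ t ∈ T, ‖secondDiff v t x / (t : ℂ) ^ 2‖ ≤ B t) :
    ∃ g : ℝ → ℂ, Continuous g ∧ ∀ ψ : ℝ → ℂ, Continuous ψ → HasCompactSupport ψ →
      HasPairing T v ψ (∫ x, ψ x * g x) := by
  have hm := measurable_secondDiff_div hv.measurable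
  have hmx : ∀ x, AEStronglyMeasurable (fun t : ℝ => secondDiff v t x / (t : ℂ) ^ 2)
      (volume.restrict T) := fun x =>
    (hm.comp (measurable_const.prodMk measurable_id)).aestronglyMeasurable
  have hct : ∀ t, Continuous fun x => secondDiff v t x / (t : ℂ) ^ 2 := fun t => by
    simp only [secondDiff]
    fun_prop
  have hnear : ∀ x : ℝ, ∀ᶠ y in 𝓝 x, |y| ≤ |x| + 1 := fun x =>
    (continuous_abs.tendsto x).eventually_le_const (by linarith)
  -- Dominated convergence: the bound for radius |x| + 1 serves a whole neighbourhood of x.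
  have hg : Continuous fun x => ∫ t in T, secondDiff v t x / (t : ℂ) ^ 2 := by
    refine continuous_iff_continuousAt.2 fun x => ?_
    obtain ⟨B, hBi, hB⟩ := hb (|x| + 1)
    refine continuousAt_of_dominated (Eventually.of_forall hmx) ((hnear x).mono fun y hy => ?_) hBi
      (Eventually.of_forall fun t => (hct t).continuousAt)
    exact (ae_restrict_iff' hT).2 (Eventually.of_forall fun t ht => hB y hy t ht)
  have hK : Continuous fun x => ∫ t in T, ‖secondDiff v t x / (t : ℂ) ^ 2‖ := by
    refine continuous_iff_continuousAt.2 fun x => ?_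
    obtain ⟨B, hBi, hB⟩ := hb (|x| + 1)
    refine continuousAt_of_dominated (Eventually.of_forall fun y => (hmx y).norm)
      ((hnear x).mono fun y hy => ?_) hBi
      (Eventually.of_forall fun t => (hct t).norm.continuousAt)
    refine (ae_restrict_iff' hT).2 (Eventually.of_forall fun t ht => ?_)
    rw [norm_norm]
    exact hB y hy t ht
  refine ⟨_, hg, fun ψ hψ hc => hasPairing_of_integral_norm_le hv.measurable hψ hc
    hK.locallyIntegrable (Eventually.of_forall fun x => ?_) (Eventually.of_forall fun x => le_rfl)⟩
  obtain ⟨B, hBi, hB⟩ := hb |x|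
  exact hBi.mono' (hmx x)
    ((ae_restrict_iff' hT).2 (Eventually.of_forall fun t ht => hB x le_rfl t ht))

/-! ### The second differences of the Heaviside function -/

lemma integral_inv_sq_Ioi {c : ℝ} (hc : 0 < c) :
    IntegrableOn (fun t : ℝ => (t ^ 2)⁻¹) (Ioi c) ∧ ∫ t in Ioi c, (t ^ 2)⁻¹ = c⁻¹ := by
  have hd : ∀ t ∈ Ici c, HasDerivAt (fun t : ℝ => -t⁻¹) ((t ^ 2)⁻¹) t := fun t ht => by
    exact (hasDerivAt_inv (lt_of_lt_of_le hc ht).ne').neg.congr_deriv (neg_neg _)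
  have hn : ∀ t ∈ Ioi c, 0 ≤ (t ^ 2)⁻¹ := fun t _ => by positivity
  have hl : Tendsto (fun t : ℝ => -t⁻¹) atTop (𝓝 0) := by
    simpa using (tendsto_inv_atTop_zero (𝕜 := ℝ)).neg
  refine ⟨integrableOn_Ioi_deriv_of_nonneg' hd hn hl, ?_⟩
  rw [integral_Ioi_of_hasDerivAt_of_nonneg' hd hn hl]
  simp

lemma integral_eq_integral_Ioi_add_neg {f : ℝ → ℂ} (hf : Integrable f) :
    ∫ x, f x = ∫ x in Ioi (0 : ℝ), (f x + f (-x)) := by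
  rw [integral_add hf.integrableOn hf.comp_neg.integrableOn, integral_comp_neg_Ioi 0 f, neg_zero,
    add_comm, intervalIntegral.integral_Iic_add_Ioi hf.integrableOn hf.integrableOn]

/-- The second difference of h₀ is the sign of x for 0 < |x| < t and vanishes for |x| > t; folding
the line at 0 leaves the odd part of ψ. The indicator is written in the variable t to suit Fubini.
-/
lemma integral_mul_secondDiff_heaviside {ψ : ℝ → ℂ} (hψ : Continuous ψ)
    (hc : HasCompactSupport ψ) {t : ℝ} (ht : 0 < t) :
    ∫ x, ψ x * secondDiff (fun x => (heaviside x : ℂ)) t x =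
      ∫ s in Ioi (0 : ℝ), (Ioi s).indicator (fun _ => ψ s - ψ (-s)) t := by
  have hl : LocallyIntegrable fun x => (heaviside x : ℂ) :=
    fun x => (locallyIntegrable_heaviside x).imp fun _ h => ⟨h.1, h.2.ofReal⟩
  rw [integral_eq_integral_Ioi_add_neg (integrable_mul_secondDiff hl hψ hc t)]
  -- At s = t the value h₀(0) = 1 spoils the formula, so this null set is discarded.
  have hne : ∀ᵐ s : ℝ, s ≠ t := by simp [ae_iff, measure_singleton]
  refine integral_congr_ae ?_
  filter_upwards [ae_restrict_of_ae hne, ae_restrict_mem measurableSet_Ioi] with s hs hs0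
  have hs0' : 0 < s := hs0
  rcases lt_or_gt_of_ne hs with h | h
  · rw [indicator_of_mem (show t ∈ Ioi s from h)]
    simp only [secondDiff, heaviside]
    rw [if_pos hs0'.le, if_pos (by linarith), if_neg (by linarith), if_neg (by linarith),
      if_pos (by linarith), if_neg (by linarith)]
    push_cast
    ring
  · rw [indicator_of_notMem (show t ∉ Ioi s from not_lt.2 h.le)]
    simp only [secondDiff, heaviside]
    rw [if_pos hs0'.le, if_pos (by linarith), if_pos (by linarith), if_neg (by linarith),
      if_neg (by linarith), if_neg (by linarith)]
    push_cast
    ring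

/-- `hasPairing_of_integral_norm_le` is unusable here: integrating t⁻² over t > |x| gives 1/|x|,
which is not locally integrable. Folding the line first replaces ψ by ψ(s) - ψ(-s), and the quotient
by s is integrable. -/
lemma hasPairing_heaviside (ψ : 𝓢(ℝ, ℂ)) (hc : HasCompactSupport ψ) :
    HasPairing (Ioi 0) (fun x => (heaviside x : ℂ)) ψ (pvInv ψ) := by
  rw [pvInv_apply, pvIntegral_eq]
  set μ := volume.restrict (Ioi (0 : ℝ)) with hμ
  set D : ℝ → ℂ := fun s => ψ s - ψ (-s) with hD
  set F : ℝ → ℝ → ℂ := fun s t => (Ioi s).indicator (fun t : ℝ => D s * (((t ^ 2)⁻¹ : ℝ) : ℂ)) t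
    with hFdef
  have hDm : Measurable D := by
    have := ψ.continuous.measurable
    fun_prop
  have hm : AEStronglyMeasurable (Function.uncurry F) (μ.prod μ) := by
    have h1 : Function.uncurry F = {p : ℝ × ℝ | p.1 < p.2}.indicator
        (fun p : ℝ × ℝ => D p.1 * (((p.2 ^ 2)⁻¹ : ℝ) : ℂ)) := by
      funext p
      by_cases h : p.1 < p.2
      · simp [F, Function.uncurry_def, indicator, h]
      · simp [F, Function.uncurry_def, indicator, h]
    rw [h1]
    refine (Measurable.indicator ?_ (measurableSet_lt measurable_fst
      measurable_snd)).aestronglyMeasurable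
    fun_prop
  have hset : ∀ {s : ℝ}, 0 < s → Ioi (0 : ℝ) ∩ Ioi s = Ioi s := fun hs =>
    inter_eq_self_of_subset_right (Ioi_subset_Ioi hs.le)
  have hl : ∀ s ∈ Ioi (0 : ℝ), ∫ t, F s t ∂μ = D s / s := fun s hs => by
    simp only [F]
    rw [hμ, setIntegral_indicator measurableSet_Ioi, hset hs, integral_const_mul,
      integral_complex_ofReal, (integral_inv_sq_Ioi hs).2, Complex.ofReal_inv, div_eq_mul_inv]
  have hF : Integrable (Function.uncurry F) (μ.prod μ) := by
    rw [integrable_prod_iff hm]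
    constructor
    · refine (ae_restrict_iff' measurableSet_Ioi).2 (Eventually.of_forall fun s hs => ?_)
      simp only [Function.uncurry_apply_pair, F]
      rw [hμ, integrable_indicator_iff measurableSet_Ioi, IntegrableOn,
        Measure.restrict_restrict measurableSet_Ioi, inter_comm, hset hs]
      exact ((integral_inv_sq_Ioi hs).1.ofReal (𝕜 := ℂ)).const_mul _
    · refine (integrableOn_pv ψ).norm.congr ?_
      refine (ae_restrict_iff' measurableSet_Ioi).2 (Eventually.of_forall fun s hs => ?_)
      simp only [Function.uncurry_apply_pair, F, norm_indicator_eq_indicator_norm]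
      rw [hμ, setIntegral_indicator measurableSet_Ioi, hset hs]
      have : ∀ t : ℝ, ‖D s * (((t ^ 2)⁻¹ : ℝ) : ℂ)‖ = ‖D s‖ * (t ^ 2)⁻¹ := fun t => by
        rw [norm_mul, Complex.norm_real, Real.norm_of_nonneg (by positivity)]
      simp only [this]
      rw [integral_const_mul, (integral_inv_sq_Ioi hs).2, norm_div, Complex.norm_real,
        Real.norm_of_nonneg (le_of_lt hs), div_eq_mul_inv]
  have hr : (fun t => ∫ s, F s t ∂μ) =ᵐ[μ] pairing (fun x => (heaviside x : ℂ)) ψ := by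
    refine (ae_restrict_iff' measurableSet_Ioi).2 (Eventually.of_forall fun t ht => ?_)
    rw [pairing, integral_mul_secondDiff_heaviside ψ.continuous hc ht, ← integral_div]
    refine integral_congr_ae (Eventually.of_forall fun s => ?_)
    simp only [F, indicator]
    split_ifs
    · push_cast
      rw [div_eq_mul_inv]
    · simp
  refine ⟨hF.integral_prod_right.congr hr, ?_⟩
  rw [← integral_congr_ae hr, ← integral_integral_swap hF]
  exact setIntegral_congr_fun measurableSet_Ioi hl

/-! ### The second differences of the positive part -/

lemma locallyIntegrable_of_intervalIntegrable {f : ℝ → ℝ}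
    (hf : ∀ a b, IntervalIntegrable f volume a b) : LocallyIntegrable f := fun x =>
  ⟨Ioc (x - 1) (x + 1), Ioc_mem_nhds (by linarith) (by linarith),
    (intervalIntegrable_iff_integrableOn_Ioc_of_le (by linarith)).1 (hf (x - 1) (x + 1))⟩

lemma locallyIntegrable_log_abs : LocallyIntegrable fun x : ℝ => Real.log |x| := by
  simp only [Real.log_abs]
  exact locallyIntegrable_of_intervalIntegrable fun _ _ => intervalIntegral.intervalIntegrable_log'

/-- The continuous difference between `log |x|` and the singular integral of the positive part. -/
noncomputable def logCorrection (x : ℝ) : ℝ := max (1 - |x|) 0 - Real.log (max |x| 1)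

lemma continuous_logCorrection : Continuous logCorrection := by
  refine Continuous.sub (by fun_prop) (Continuous.log (by fun_prop) fun x => ?_)
  exact (lt_of_lt_of_le one_pos (le_max_right _ _)).ne'

/-- For a < 1 the primitive log t + a/t on [a, 1] gives -(log a + 1 - a). For a ≥ 1 the integrand
vanishes and `logCorrection` cancels the logarithm. -/
lemma integral_posPart_sub_div_sq {a : ℝ} (ha : 0 < a) :
    IntegrableOn (fun t : ℝ => max (t - a) 0 / t ^ 2) (Ioc 0 1) ∧
      ∫ t in Ioc (0 : ℝ) 1, max (t - a) 0 / t ^ 2 = -(Real.log |a| + logCorrection a) := by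
  have hz : ∀ t ∈ Ioc 0 a, max (t - a) 0 / t ^ 2 = (0 : ℝ) := fun t ht => by
    rw [max_eq_right (by linarith [ht.2]), zero_div]
  simp only [logCorrection, abs_of_pos ha]
  rcases le_or_gt 1 a with h | h
  · have hz' : ∀ t ∈ Ioc (0 : ℝ) 1, max (t - a) 0 / t ^ 2 = (0 : ℝ) := fun t ht =>
      hz t ⟨ht.1, ht.2.trans h⟩
    refine ⟨integrableOn_zero.congr_fun (fun t ht => (hz' t ht).symm) measurableSet_Ioc, ?_⟩
    rw [setIntegral_congr_fun measurableSet_Ioc hz', integral_zero, max_eq_right (by linarith),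
      max_eq_left h]
    ring
  · have hd : ∀ t ∈ uIcc a 1, HasDerivAt (fun t : ℝ => Real.log t + a * t⁻¹)
        (max (t - a) 0 / t ^ 2) t := fun t ht => by
      rw [uIcc_of_le h.le] at ht
      have ht0 : t ≠ 0 := (lt_of_lt_of_le ha ht.1).ne'
      refine ((Real.hasDerivAt_log ht0).add ((hasDerivAt_inv ht0).const_mul a)).congr_deriv ?_
      rw [max_eq_left (by linarith [ht.1])]
      field_simp
      ring
    have hi : IntervalIntegrable (fun t : ℝ => max (t - a) 0 / t ^ 2) volume a 1 := by
      refine ContinuousOn.intervalIntegrable ?_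
      rw [uIcc_of_le h.le]
      exact ContinuousOn.div (by fun_prop) (by fun_prop) fun t ht =>
        pow_ne_zero 2 (lt_of_lt_of_le ha ht.1).ne'
    have h1 : IntegrableOn (fun t : ℝ => max (t - a) 0 / t ^ 2) (Ioc 0 a) :=
      integrableOn_zero.congr_fun (fun t ht => (hz t ht).symm) measurableSet_Ioc
    have h2 := (intervalIntegrable_iff_integrableOn_Ioc_of_le h.le).1 hi
    have hu : Ioc (0 : ℝ) 1 = Ioc 0 a ∪ Ioc a 1 := (Ioc_union_Ioc_eq_Ioc ha.le h.le).symm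
    rw [hu]
    refine ⟨h1.union h2, ?_⟩
    rw [setIntegral_union (Ioc_disjoint_Ioc_of_le le_rfl) measurableSet_Ioc h1 h2,
      setIntegral_congr_fun measurableSet_Ioc hz, integral_zero,
      ← intervalIntegral.integral_of_le h.le,
      intervalIntegral.integral_eq_sub_of_hasDerivAt hd hi, max_eq_left (by linarith),
      max_eq_right h.le, Real.log_one, mul_inv_cancel₀ ha.ne']
    ring

lemma secondDiff_posPart {t : ℝ} (ht : 0 ≤ t) (x : ℝ) :
    secondDiff (fun x => ((max x 0 : ℝ) : ℂ)) t x = ((-max (t - |x|) 0 : ℝ) : ℂ) := by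
  simp only [secondDiff]
  norm_cast
  rcases abs_cases x with ⟨h, _⟩ | ⟨h, _⟩ <;> rw [h] <;>
    rcases max_cases x 0 with ⟨h1, _⟩ | ⟨h1, _⟩ <;> rw [h1] <;>
    rcases max_cases (x + t) 0 with ⟨h2, _⟩ | ⟨h2, _⟩ <;> rw [h2] <;>
    rcases max_cases (x - t) 0 with ⟨h3, _⟩ | ⟨h3, _⟩ <;> rw [h3] <;>
    first
    | (rcases max_cases (t - x) 0 with ⟨h4, _⟩ | ⟨h4, _⟩ <;> rw [h4] <;> linarith)
    | (rcases max_cases (t - -x) 0 with ⟨h4, _⟩ | ⟨h4, _⟩ <;> rw [h4] <;> linarith)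

/-- Only t ≤ 1 is used, since (t - |x|)₊/t² has a logarithmically divergent integral at infinity. -/
lemma hasPairing_posPart (ψ : 𝓢(ℝ, ℂ)) (hc : HasCompactSupport ψ) :
    HasPairing (Ioc 0 1) (fun x => ((max x 0 : ℝ) : ℂ)) ψ
      (logAbs ψ + ∫ x, ψ x * ((logCorrection x : ℝ) : ℂ)) := by
  have hne : ∀ᵐ x : ℝ, x ≠ 0 := by simp [ae_iff, measure_singleton]
  have hG : LocallyIntegrable fun x => Real.log |x| + logCorrection x :=
    locallyIntegrable_log_abs.add continuous_logCorrection.locallyIntegrable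
  have hform : ∀ x, ∀ t ∈ Ioc (0 : ℝ) 1,
      secondDiff (fun x => ((max x 0 : ℝ) : ℂ)) t x / (t : ℂ) ^ 2 =
        -((max (t - |x|) 0 / t ^ 2 : ℝ) : ℂ) := fun x t ht => by
    rw [secondDiff_posPart ht.1.le]
    push_cast
    ring
  have hcorr : ∀ x, logCorrection |x| = logCorrection x := fun x => by
    simp only [logCorrection, abs_abs]
  -- The integrand has constant sign, so the dominating function is minus the value of the integral
  -- itself.
  have h := hasPairing_of_integral_norm_le (T := Ioc 0 1) (v := fun x => ((max x 0 : ℝ) : ℂ))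
    (by fun_prop) ψ.continuous hc hG.neg ?_ ?_
  · have hval : (∫ x, ψ x * ∫ t in Ioc (0 : ℝ) 1,
        secondDiff (fun x => ((max x 0 : ℝ) : ℂ)) t x / (t : ℂ) ^ 2) =
        logAbs ψ + ∫ x, ψ x * ((logCorrection x : ℝ) : ℂ) := by
      have hi1 := isTempered_logAbs.integrable_mul ψ
      have hi2 : Integrable fun x => ψ x * ((logCorrection x : ℝ) : ℂ) :=
        (Complex.continuous_ofReal.comp continuous_logCorrection).locallyIntegrable
          |>.integrable_smul_left_of_hasCompactSupport ψ.continuous hc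
      rw [logAbs, ofFun_apply isTempered_logAbs, ← integral_add hi1 hi2]
      refine integral_congr_ae (hne.mono fun x hx => ?_)
      simp only
      rw [setIntegral_congr_fun measurableSet_Ioc (hform x), integral_neg,
        integral_complex_ofReal, (integral_posPart_sub_div_sq (abs_pos.2 hx)).2, hcorr, abs_abs]
      push_cast
      ring
    rwa [hval] at h
  · refine hne.mono fun x hx => ?_
    refine IntegrableOn.congr_fun ?_ (fun t ht => (hform x t ht).symm) measurableSet_Ioc
    exact ((integral_posPart_sub_div_sq (abs_pos.2 hx)).1.ofReal (𝕜 := ℂ)).neg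
  · refine hne.mono fun x hx => ?_
    have : ∀ t ∈ Ioc (0 : ℝ) 1,
        ‖secondDiff (fun x => ((max x 0 : ℝ) : ℂ)) t x / (t : ℂ) ^ 2‖ =
          max (t - |x|) 0 / t ^ 2 := fun t ht => by
      rw [hform x t ht, norm_neg, Complex.norm_real, Real.norm_of_nonneg (by positivity)]
    rw [setIntegral_congr_fun measurableSet_Ioc this,
      (integral_posPart_sub_div_sq (abs_pos.2 hx)).2, hcorr, abs_abs]
    exact le_rfl

/-! ### The second differences of the square root -/

/-- The symmetric second difference of the square root (which vanishes on the negative axis). -/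
noncomputable def sqrtSecondDiff (t x : ℝ) : ℝ := 2 * √x - √(x + t) - √(x - t)

lemma sqrtSecondDiff_mul {a : ℝ} (ha : 0 ≤ a) (t x : ℝ) :
    sqrtSecondDiff (a * t) (a * x) = √a * sqrtSecondDiff t x := by
  rw [sqrtSecondDiff, sqrtSecondDiff, ← mul_add, ← mul_sub, Real.sqrt_mul ha, Real.sqrt_mul ha,
    Real.sqrt_mul ha]
  ring

/-- Only the translate -1 + t reaches the positive axis, and only for t > 1; the primitive there is
arctan √(t-1) - √(t-1)/t. -/
lemma integral_sqrtSecondDiff_neg_one :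
    IntegrableOn (fun t : ℝ => sqrtSecondDiff t (-1) / t ^ 2) (Ioi 0) ∧
      ∫ t in Ioi (0 : ℝ), sqrtSecondDiff t (-1) / t ^ 2 = -(Real.pi / 2) := by
  have hform : ∀ t ∈ Ioi (0 : ℝ), sqrtSecondDiff t (-1) / t ^ 2 = -(√(t - 1) / t ^ 2) :=
    fun t ht => by
      have ht' : 0 < t := ht
      rw [sqrtSecondDiff, Real.sqrt_eq_zero_of_nonpos (show (-1 : ℝ) ≤ 0 by norm_num),
        Real.sqrt_eq_zero_of_nonpos (show -1 - t ≤ 0 by linarith), show -1 + t = t - 1 by ring]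
      ring
  have hz : ∀ t ∈ Ioc (0 : ℝ) 1, √(t - 1) / t ^ 2 = 0 := fun t ht => by
    rw [Real.sqrt_eq_zero_of_nonpos (by linarith [ht.2]), zero_div]
  have hd : ∀ t ∈ Ioi (1 : ℝ), HasDerivAt (fun t : ℝ => Real.arctan √(t - 1) - √(t - 1) / t)
      (√(t - 1) / t ^ 2) t := fun t ht => by
    have ht' : 1 < t := ht
    have h1 : 0 < t - 1 := by linarith
    have hs : HasDerivAt (fun t : ℝ => √(t - 1)) (1 / (2 * √(t - 1))) t :=
      ((hasDerivAt_id t).sub_const 1).sqrt h1.ne'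
    have hp : 0 < √(t - 1) := Real.sqrt_pos.2 h1
    have hsq : √(t - 1) ^ 2 = t - 1 := Real.sq_sqrt h1.le
    have ht0 : t ≠ 0 := by linarith
    refine (hs.arctan.sub (hs.div (hasDerivAt_id t) ht0)).congr_deriv ?_
    rw [hsq, show 1 + (t - 1) = t by ring, id]
    field_simp
    rw [hsq]
    ring
  have hc : ContinuousWithinAt (fun t : ℝ => Real.arctan √(t - 1) - √(t - 1) / t) (Ici 1) 1 := by
    refine ContinuousAt.continuousWithinAt ?_
    have h1 : Continuous fun t : ℝ => √(t - 1) := by fun_prop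
    exact ((Real.continuous_arctan.comp h1).continuousAt).sub
      (h1.continuousAt.div continuousAt_id one_ne_zero)
  have hl : Tendsto (fun t : ℝ => Real.arctan √(t - 1) - √(t - 1) / t) atTop
      (𝓝 (Real.pi / 2)) := by
    have h1 : Tendsto (fun t : ℝ => √(t - 1)) atTop atTop :=
      Real.tendsto_sqrt_atTop.comp (tendsto_atTop_add_const_right _ (-1) tendsto_id)
    have h2 : Tendsto (fun t : ℝ => Real.arctan √(t - 1)) atTop (𝓝 (Real.pi / 2)) :=
      (Real.tendsto_arctan_atTop.mono_right nhdsWithin_le_nhds).comp h1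
    have h3 : Tendsto (fun t : ℝ => √(t - 1) / t) atTop (𝓝 0) := by
      refine squeeze_zero' ?_ ?_
        (tendsto_inv_atTop_zero.comp Real.tendsto_sqrt_atTop)
      · filter_upwards [eventually_gt_atTop 0] with t ht
        positivity
      · filter_upwards [eventually_gt_atTop 0] with t ht
        rw [Function.comp, div_le_iff₀ ht]
        have : √t * √t = t := Real.mul_self_sqrt ht.le
        have hp : 0 < √t := Real.sqrt_pos.2 ht
        have he : (√t)⁻¹ * t = √t := by
          field_simp
          linarith
        rw [he]
        exact Real.sqrt_le_sqrt (by linarith)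
    simpa using h2.sub h3
  have hn : ∀ t ∈ Ioi (1 : ℝ), 0 ≤ √(t - 1) / t ^ 2 := fun t _ => by positivity
  have h1 : IntegrableOn (fun t : ℝ => √(t - 1) / t ^ 2) (Ioc 0 1) :=
    integrableOn_zero.congr_fun (fun t ht => (hz t ht).symm) measurableSet_Ioc
  have h2 := integrableOn_Ioi_deriv_of_nonneg hc hd hn hl
  have hu : Ioi (0 : ℝ) = Ioc 0 1 ∪ Ioi 1 := (Ioc_union_Ioi_eq_Ioi zero_le_one).symm
  refine ⟨IntegrableOn.congr_fun (hu ▸ (h1.union h2)).neg (fun t ht => (hform t ht).symm)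
    measurableSet_Ioi, ?_⟩
  rw [setIntegral_congr_fun measurableSet_Ioi hform, integral_neg, hu,
    setIntegral_union (Ioc_disjoint_Ioi le_rfl) measurableSet_Ioi h1 h2,
    setIntegral_congr_fun measurableSet_Ioc hz, integral_zero,
    integral_Ioi_of_hasDerivAt_of_nonneg hc hd hn hl]
  simp

lemma integral_sqrtSecondDiff_one_Ioc :
    IntegrableOn (fun t : ℝ => sqrtSecondDiff t 1 / t ^ 2) (Ioc 0 1) ∧
      ∫ t in Ioc (0 : ℝ) 1, sqrtSecondDiff t 1 / t ^ 2 = √2 - 2 + Real.log (1 + √2) := by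
  -- Rationalizing (√(1±t) - 1)/t removes the apparent singularity at t = 0 and displays the
  -- integrand as a nonnegative sum of squares, so integrability follows from the primitive.
  have hform : ∀ t ∈ Ioo (0 : ℝ) 1, sqrtSecondDiff t 1 / t ^ 2 =
      ((1 + √(1 + t))⁻¹ ^ 2 + (1 + √(1 - t))⁻¹ ^ 2) / 2 := fun t ht => by
    have hr : √(1 + t) ^ 2 = 1 + t := Real.sq_sqrt (by linarith [ht.1])
    have hs : √(1 - t) ^ 2 = 1 - t := Real.sq_sqrt (by linarith [ht.2])
    have hr0 := Real.sqrt_nonneg (1 + t)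
    have hs0 := Real.sqrt_nonneg (1 - t)
    have ht0 : t ≠ 0 := ht.1.ne'
    have e1 : (1 + √(1 + t))⁻¹ = (√(1 + t) - 1) / t := by
      field_simp
      linear_combination -hr
    have e2 : (1 + √(1 - t))⁻¹ = (1 - √(1 - t)) / t := by
      field_simp
      linear_combination hs
    rw [sqrtSecondDiff, Real.sqrt_one, e1, e2]
    field_simp
    linear_combination -hr - hs
  have hd : ∀ t ∈ Ioo (0 : ℝ) 1, HasDerivAt (fun t : ℝ => (1 + √(1 + t))⁻¹ - (1 + √(1 - t))⁻¹ +
      (Real.log (1 + √(1 + t)) - Real.log (1 + √(1 - t)))) (sqrtSecondDiff t 1 / t ^ 2) t :=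
    fun t ht => by
      have h1 : 0 < 1 + t := by linarith [ht.1]
      have h2 : 0 < 1 - t := by linarith [ht.2]
      have hr : HasDerivAt (fun t : ℝ => 1 + √(1 + t)) (1 / (2 * √(1 + t))) t :=
        (((hasDerivAt_id t).const_add 1).sqrt h1.ne').const_add 1
      have hs : HasDerivAt (fun t : ℝ => 1 + √(1 - t)) (-1 / (2 * √(1 - t))) t :=
        (((hasDerivAt_id t).const_sub 1).sqrt h2.ne').const_add 1
      have hr0 : 0 < √(1 + t) := Real.sqrt_pos.2 h1
      have hs0 : 0 < √(1 - t) := Real.sqrt_pos.2 h2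
      have hr1 : (1 + √(1 + t)) ≠ 0 := by positivity
      have hs1 : (1 + √(1 - t)) ≠ 0 := by positivity
      rw [hform t ht]
      refine (((hr.inv hr1).sub (hs.inv hs1)).add ((hr.log hr1).sub (hs.log hs1))).congr_deriv ?_
      field_simp
      ring
  have hc : Continuous (fun t : ℝ => (1 + √(1 + t))⁻¹ - (1 + √(1 - t))⁻¹ +
      (Real.log (1 + √(1 + t)) - Real.log (1 + √(1 - t)))) := by
    have h0 : ∀ y : ℝ, 1 + √y ≠ 0 := fun y => by positivity
    have h1 : Continuous fun t : ℝ => 1 + √(1 + t) := by fun_prop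
    have h2 : Continuous fun t : ℝ => 1 + √(1 - t) := by fun_prop
    exact ((h1.inv₀ fun t => h0 _).sub (h2.inv₀ fun t => h0 _)).add
      ((h1.log fun t => h0 _).sub (h2.log fun t => h0 _))
  have hi := intervalIntegral.integrableOn_deriv_of_nonneg hc.continuousOn hd fun t ht => by
    rw [hform t ht]
    positivity
  refine ⟨hi, ?_⟩
  rw [← intervalIntegral.integral_of_le zero_le_one,
    intervalIntegral.integral_eq_sub_of_hasDerivAt_of_le zero_le_one hc.continuousOn hd
      ((intervalIntegrable_iff_integrableOn_Ioc_of_le zero_le_one).2 hi)]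
  have h2 : (1 + √2)⁻¹ = √2 - 1 := by
    have := Real.sq_sqrt (zero_le_two (α := ℝ))
    field_simp
    linear_combination -this
  norm_num
  rw [h2]
  ring

lemma integral_sqrtSecondDiff_one_Ioi :
    IntegrableOn (fun t : ℝ => sqrtSecondDiff t 1 / t ^ 2) (Ioi 1) ∧
      ∫ t in Ioi (1 : ℝ), sqrtSecondDiff t 1 / t ^ 2 = -(√2 - 2 + Real.log (1 + √2)) := by
  have hform : ∀ t ∈ Ioi (1 : ℝ), sqrtSecondDiff t 1 = 2 - √(1 + t) := fun t ht => by
    have ht' : 1 < t := ht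
    rw [sqrtSecondDiff, Real.sqrt_one,
      Real.sqrt_eq_zero_of_nonpos (show 1 - t ≤ 0 by linarith)]
    ring
  -- The numerator 2 - √(1+t) changes sign at t = 3, so integrability needs its own bound before the
  -- primitive is used.
  have hi : IntegrableOn (fun t : ℝ => sqrtSecondDiff t 1 / t ^ 2) (Ioi 1) := by
    have hb : IntegrableOn (fun t : ℝ => 2 * t ^ (-(3 / 2) : ℝ)) (Ioi 1) :=
      (integrableOn_Ioi_rpow_of_lt (by norm_num) one_pos).const_mul 2
    have hm : Measurable fun t : ℝ => sqrtSecondDiff t 1 / t ^ 2 := by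
      simp only [sqrtSecondDiff]
      fun_prop
    refine hb.mono' hm.aestronglyMeasurable
      ((ae_restrict_iff' measurableSet_Ioi).2 (Eventually.of_forall fun t ht => ?_))
    have ht' : 1 < t := ht
    have h0 : 0 < t := by linarith
    rw [hform t ht, norm_div, Real.norm_eq_abs, Real.norm_of_nonneg (by positivity),
      div_le_iff₀ (by positivity)]
    have he : 2 * t ^ (-(3 / 2) : ℝ) * t ^ 2 = 2 * √t := by
      rw [Real.sqrt_eq_rpow, mul_assoc, ← Real.rpow_natCast t 2, ← Real.rpow_add h0]
      norm_num
    have h1 : 1 ≤ √t := Real.one_le_sqrt.2 ht'.le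
    have h2 : √(1 + t) ≤ 2 * √t := Real.sqrt_le_iff.2 ⟨by positivity, by
      rw [mul_pow, Real.sq_sqrt h0.le]
      linarith⟩
    rw [he, abs_le]
    constructor <;> linarith [Real.sqrt_nonneg (1 + t)]
  have hd : ∀ t ∈ Ioi (1 : ℝ), HasDerivAt
      (fun t : ℝ => -((2 - √(1 + t)) / t) + (Real.log (1 + √(1 + t)) - Real.log t / 2))
      (sqrtSecondDiff t 1 / t ^ 2) t := fun t ht => by
    have ht' : 1 < t := ht
    have ht0 : t ≠ 0 := by linarith
    have h1 : 0 < 1 + t := by linarith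
    have hr : HasDerivAt (fun t : ℝ => √(1 + t)) (1 / (2 * √(1 + t))) t :=
      ((hasDerivAt_id t).const_add 1).sqrt h1.ne'
    have hr0 : 0 < √(1 + t) := Real.sqrt_pos.2 h1
    have hr1 : (1 + √(1 + t)) ≠ 0 := by positivity
    have hsq : √(1 + t) ^ 2 = 1 + t := Real.sq_sqrt h1.le
    rw [hform t ht]
    refine (((hr.const_sub 2).div (hasDerivAt_id t) ht0).neg.add
      (((hr.const_add 1).log hr1).sub ((Real.hasDerivAt_log ht0).div_const 2))).congr_deriv ?_
    simp only [id]
    field_simp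
    linear_combination -t * hsq
  have hc : ContinuousWithinAt
      (fun t : ℝ => -((2 - √(1 + t)) / t) + (Real.log (1 + √(1 + t)) - Real.log t / 2))
      (Ici 1) 1 := by
    refine ContinuousAt.continuousWithinAt ?_
    have h1 : Continuous fun t : ℝ => √(1 + t) := by fun_prop
    refine (((continuous_const.sub h1).continuousAt.div continuousAt_id one_ne_zero).neg).add
      (ContinuousAt.sub ?_ ((Real.continuousAt_log one_ne_zero).div_const 2))
    exact ((continuous_const.add h1).log fun t => show 1 + √(1 + t) ≠ 0 by positivity).continuousAt
  have hl : Tendsto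
      (fun t : ℝ => -((2 - √(1 + t)) / t) + (Real.log (1 + √(1 + t)) - Real.log t / 2))
      atTop (𝓝 0) := by
    -- Written in terms of 1/t, the two divergent logarithms merge into one that is continuous at
    -- 1/t = 0.
    have hinv : Tendsto (fun t : ℝ => t⁻¹) atTop (𝓝 0) := tendsto_inv_atTop_zero
    have hq : Tendsto (fun t : ℝ => √(t⁻¹ ^ 2 + t⁻¹)) atTop (𝓝 0) := by
      have := (((hinv.pow 2).add hinv)).sqrt
      simpa using this
    have hlog : Tendsto (fun t : ℝ => Real.log (√(t⁻¹) + √(t⁻¹ + 1))) atTop (𝓝 0) := by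
      have h1 := (hinv.sqrt.add ((hinv.add_const 1).sqrt)).log (by simp)
      simpa using h1
    have := ((hinv.const_mul 2).sub hq).neg.add hlog
    simp only [mul_zero, sub_zero, neg_zero, add_zero] at this
    refine this.congr' ?_
    filter_upwards [eventually_gt_atTop 0] with t ht
    have e1 : √(t⁻¹ ^ 2 + t⁻¹) = √(1 + t) / t := by
      rw [show t⁻¹ ^ 2 + t⁻¹ = (1 + t) / t ^ 2 by field_simp, Real.sqrt_div' _ (by positivity),
        Real.sqrt_sq ht.le]
    have e2 : √(t⁻¹) + √(t⁻¹ + 1) = (1 + √(1 + t)) / √t := by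
      rw [show t⁻¹ + 1 = (1 + t) / t by field_simp, Real.sqrt_div' _ ht.le, Real.sqrt_inv]
      ring
    have hp : 0 < √t := Real.sqrt_pos.2 ht
    rw [e1, e2, Real.log_div (by positivity) hp.ne', Real.log_sqrt ht.le]
    ring
  refine ⟨hi, ?_⟩
  rw [integral_Ioi_of_hasDerivAt_of_tendsto hc hd hi hl]
  norm_num

/-- The pieces on either side of t = 1 cancel exactly. This is why no |x|^{-1/2} singularity appears
on the positive side. -/
lemma integral_sqrtSecondDiff_one :
    IntegrableOn (fun t : ℝ => sqrtSecondDiff t 1 / t ^ 2) (Ioi 0) ∧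
      ∫ t in Ioi (0 : ℝ), sqrtSecondDiff t 1 / t ^ 2 = 0 := by
  obtain ⟨h1, e1⟩ := integral_sqrtSecondDiff_one_Ioc
  obtain ⟨h2, e2⟩ := integral_sqrtSecondDiff_one_Ioi
  have hu : Ioi (0 : ℝ) = Ioc 0 1 ∪ Ioi 1 := (Ioc_union_Ioi_eq_Ioi zero_le_one).symm
  rw [hu]
  refine ⟨h1.union h2, ?_⟩
  rw [setIntegral_union (Ioc_disjoint_Ioi le_rfl) measurableSet_Ioi h1 h2, e1, e2]
  ring

/-! ### Homogeneity: from x = ±1 to every x ≠ 0. -/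

lemma locallyIntegrable_inv_sqrt_abs : LocallyIntegrable fun x : ℝ => (√|x|)⁻¹ := by
  refine locallyIntegrable_of_intervalIntegrable fun a b => ?_
  have h : ∀ a b, IntervalIntegrable (fun x : ℝ => (√x)⁻¹) volume a b := fun a b => by
    refine (intervalIntegral.intervalIntegrable_rpow' (r := -(1 / 2))
      (by norm_num)).mono_fun (by
        have : Measurable fun x : ℝ => (√x)⁻¹ := by fun_prop
        exact this.aestronglyMeasurable) (Eventually.of_forall fun x => ?_)
    simp only
    rcases le_or_gt x 0 with hx | hx
    · rw [Real.sqrt_eq_zero_of_nonpos hx, inv_zero, norm_zero]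
      exact norm_nonneg _
    · rw [Real.sqrt_eq_rpow, Real.rpow_neg hx.le]
  have h' : IntervalIntegrable (fun x : ℝ => (√(-x))⁻¹) volume a b := by
    have := (h (-a) (-b)).comp_sub_left 0
    simpa using this
  -- Because √ vanishes on negative numbers and 0⁻¹ = 0, the two one-sided functions add up to
  -- (√|x|)⁻¹ everywhere.
  refine ((h a b).add h').congr fun x _ => ?_
  rcases le_total x 0 with hx | hx
  · rw [Real.sqrt_eq_zero_of_nonpos hx, abs_of_nonpos hx, inv_zero, zero_add]
  · rw [Real.sqrt_eq_zero_of_nonpos (neg_nonpos.2 hx), abs_of_nonneg hx, inv_zero, add_zero]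

/-- Substitute at for t: the degrees 1/2 from the root, -2 from the kernel and 1 from dt add up to
-1/2. It is applied with ε = ±1. -/
lemma integral_sqrtSecondDiff_comp_mul {a : ℝ} (ha : 0 < a) {ε : ℝ}
    (hε : IntegrableOn (fun t : ℝ => sqrtSecondDiff t ε / t ^ 2) (Ioi 0)) :
    IntegrableOn (fun t : ℝ => sqrtSecondDiff t (a * ε) / t ^ 2) (Ioi 0) ∧
      (∫ t in Ioi (0 : ℝ), sqrtSecondDiff t (a * ε) / t ^ 2 =
        (√a)⁻¹ * ∫ t in Ioi (0 : ℝ), sqrtSecondDiff t ε / t ^ 2) ∧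
      ∫ t in Ioi (0 : ℝ), ‖sqrtSecondDiff t (a * ε) / t ^ 2‖ =
        (√a)⁻¹ * ∫ t in Ioi (0 : ℝ), ‖sqrtSecondDiff t ε / t ^ 2‖ := by
  set g : ℝ → ℝ := fun t => sqrtSecondDiff t (a * ε) / t ^ 2
  have hs : √a * √a = a := Real.mul_self_sqrt ha.le
  have hp : 0 < √a := Real.sqrt_pos.2 ha
  have hg : (fun t => g (a * t)) = fun t => √a / a ^ 2 * (sqrtSecondDiff t ε / t ^ 2) := by
    funext t
    simp only [g, sqrtSecondDiff_mul ha.le]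
    ring
  have hconst : a * (√a / a ^ 2) = (√a)⁻¹ := by
    field_simp
    linear_combination hs
  refine ⟨?_, ?_, ?_⟩
  · have h := integrableOn_Ioi_comp_mul_left_iff g 0 ha
    rw [mul_zero] at h
    refine h.1 ?_
    rw [hg]
    exact hε.const_mul _
  · have h := integral_comp_mul_left_Ioi g 0 ha
    rw [mul_zero, smul_eq_mul, hg, integral_const_mul] at h
    rw [← hconst, mul_assoc, h, mul_inv_cancel_left₀ ha.ne']
  · have h := integral_comp_mul_left_Ioi (fun t => ‖g t‖) 0 ha
    have hn : (fun t => ‖g (a * t)‖) = fun t => √a / a ^ 2 * ‖sqrtSecondDiff t ε / t ^ 2‖ := by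
      funext t
      rw [congrFun hg t, norm_mul, Real.norm_of_nonneg (show 0 ≤ √a / a ^ 2 by positivity)]
    rw [mul_zero, smul_eq_mul, hn, integral_const_mul] at h
    rw [← hconst, mul_assoc, h, mul_inv_cancel_left₀ ha.ne']

lemma secondDiff_sqrt_div (t x : ℝ) : secondDiff (fun x => ((√x : ℝ) : ℂ)) t x / (t : ℂ) ^ 2 =
    ((sqrtSecondDiff t x / t ^ 2 : ℝ) : ℂ) := by
  simp only [secondDiff, sqrtSecondDiff]
  push_cast
  rfl

lemma integral_sqrtSecondDiff_of_ne_zero {x : ℝ} (hx : x ≠ 0) :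
    IntegrableOn (fun t : ℝ => sqrtSecondDiff t x / t ^ 2) (Ioi 0) ∧
      (∫ t in Ioi (0 : ℝ), sqrtSecondDiff t x / t ^ 2 = -(Real.pi / 2) * negPartRpow x) ∧
      ∫ t in Ioi (0 : ℝ), ‖sqrtSecondDiff t x / t ^ 2‖ ≤ (√|x|)⁻¹ *
        ((∫ t in Ioi (0 : ℝ), ‖sqrtSecondDiff t 1 / t ^ 2‖) +
          ∫ t in Ioi (0 : ℝ), ‖sqrtSecondDiff t (-1) / t ^ 2‖) := by
  have n1 : 0 ≤ ∫ t in Ioi (0 : ℝ), ‖sqrtSecondDiff t 1 / t ^ 2‖ := by positivity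
  have n2 : 0 ≤ ∫ t in Ioi (0 : ℝ), ‖sqrtSecondDiff t (-1) / t ^ 2‖ := by positivity
  rcases lt_or_gt_of_ne hx with h | h
  · obtain ⟨h1, h2, h3⟩ := integral_sqrtSecondDiff_comp_mul (abs_pos.2 hx)
      integral_sqrtSecondDiff_neg_one.1
    rw [show |x| * -1 = x by rw [abs_of_neg h]; ring] at h1 h2 h3
    refine ⟨h1, ?_, ?_⟩
    · rw [h2, integral_sqrtSecondDiff_neg_one.2, negPartRpow, if_pos h,
        Real.rpow_neg (abs_nonneg x), ← Real.sqrt_eq_rpow, mul_comm]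
    · rw [h3]
      gcongr
      linarith
  · obtain ⟨h1, h2, h3⟩ := integral_sqrtSecondDiff_comp_mul (abs_pos.2 hx)
      integral_sqrtSecondDiff_one.1
    rw [show |x| * 1 = x by rw [abs_of_pos h]; ring] at h1 h2 h3
    refine ⟨h1, ?_, ?_⟩
    · rw [h2, integral_sqrtSecondDiff_one.2, negPartRpow, if_neg (not_lt.2 h.le), mul_zero,
        mul_zero]
    · rw [h3]
      gcongr
      linarith

lemma hasPairing_sqrt (ψ : 𝓢(ℝ, ℂ)) (hc : HasCompactSupport ψ) :
    HasPairing (Ioi 0) (fun x => ((√x : ℝ) : ℂ)) ψ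
      (((-(Real.pi / 2) : ℝ) : ℂ) * negPartInvSqrt ψ) := by
  have hne : ∀ᵐ x : ℝ, x ≠ 0 := by simp [ae_iff, measure_singleton]
  set k := (∫ t in Ioi (0 : ℝ), ‖sqrtSecondDiff t 1 / t ^ 2‖) +
    ∫ t in Ioi (0 : ℝ), ‖sqrtSecondDiff t (-1) / t ^ 2‖ with hk
  have h := hasPairing_of_integral_norm_le (T := Ioi 0) (v := fun x => ((√x : ℝ) : ℂ))
    (by fun_prop) ψ.continuous hc
    (K := k • fun x => (√|x|)⁻¹) (locallyIntegrable_inv_sqrt_abs.smul k) ?_ ?_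
  · have hval : (∫ x, ψ x * ∫ t in Ioi (0 : ℝ),
        secondDiff (fun x => ((√x : ℝ) : ℂ)) t x / (t : ℂ) ^ 2) =
        ((-(Real.pi / 2) : ℝ) : ℂ) * negPartInvSqrt ψ := by
      rw [negPartInvSqrt, ofFun_apply isTempered_negPartInvSqrt, ← integral_const_mul]
      refine integral_congr_ae (hne.mono fun x hx => ?_)
      simp only [secondDiff_sqrt_div]
      rw [integral_complex_ofReal, (integral_sqrtSecondDiff_of_ne_zero hx).2.1]
      push_cast
      ring
    rwa [hval] at h
  · refine hne.mono fun x hx => ?_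
    simp only [secondDiff_sqrt_div]
    exact (integral_sqrtSecondDiff_of_ne_zero hx).1.ofReal
  · refine hne.mono fun x hx => ?_
    simp only [secondDiff_sqrt_div, Complex.norm_real]
    rw [Pi.smul_apply, smul_eq_mul, mul_comm, hk]
    exact (integral_sqrtSecondDiff_of_ne_zero hx).2.2

/-! ### Continuous remainders -/

section Taylor

variable {f : ℝ → ℂ}

/-- Compact support is asked of the derivative only, so that φ - φ(0), a nonzero constant at
infinity in general, is covered. -/
lemma exists_norm_le_of_hasCompactSupport_deriv (hf : ContDiff ℝ ∞ f)
    (hc : HasCompactSupport (deriv f)) :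
    ∃ L M : ℝ, 0 ≤ L ∧ 0 ≤ M ∧ (∀ x, ‖deriv f x‖ ≤ L) ∧
      (∀ x y, ‖deriv f x - deriv f y‖ ≤ M * |x - y|) ∧
      (∀ x y, ‖f x - f y‖ ≤ L * |x - y|) ∧
      ∀ x y, ‖f y - f x - ((y - x : ℝ) : ℂ) * deriv f x‖ ≤ M * |y - x| ^ 2 := by
  have hf1 : ContDiff ℝ ∞ (deriv f) := hf.deriv'
  have hf2 : ContDiff ℝ ∞ (deriv (deriv f)) := hf1.deriv'
  obtain ⟨L, hL⟩ := hc.exists_bound_of_continuous hf1.continuous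
  obtain ⟨M, hM⟩ := hc.deriv.exists_bound_of_continuous hf2.continuous
  have hL0 : 0 ≤ L := (norm_nonneg _).trans (hL 0)
  have hM0 : 0 ≤ M := (norm_nonneg _).trans (hM 0)
  have hd1 : Differentiable ℝ f := hf.differentiable (by simp)
  have hd2 : Differentiable ℝ (deriv f) := hf1.differentiable (by simp)
  have hlip : ∀ x y, ‖deriv f x - deriv f y‖ ≤ M * |x - y| := fun x y =>
    convex_univ.norm_image_sub_le_of_norm_deriv_le (fun z _ => hd2 z) (fun z _ => hM z)
      (mem_univ y) (mem_univ x)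
  refine ⟨L, M, hL0, hM0, hL, hlip, fun x y =>
    convex_univ.norm_image_sub_le_of_norm_deriv_le (fun z _ => hd1 z) (fun z _ => hL z)
      (mem_univ y) (mem_univ x), fun x y => ?_⟩
  -- Taylor remainder by the mean value inequality for f(z) - z f'(x), whose derivative is at most
  -- M|y - x| between x and y.
  have hd : ∀ z, HasDerivAt (fun z : ℝ => f z - (z : ℂ) * deriv f x)
      (deriv f z - 1 * deriv f x) z := fun z =>
    (hd1 z).hasDerivAt.sub ((Complex.ofRealCLM.hasDerivAt (x := z)).mul_const _)
  have h := (convex_uIcc x y).norm_image_sub_le_of_norm_deriv_le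
    (f := fun z : ℝ => f z - (z : ℂ) * deriv f x) (C := M * |y - x|)
    (fun z _ => (hd z).differentiableAt) (fun z hz => ?_) left_mem_uIcc right_mem_uIcc
  · rw [Real.norm_eq_abs] at h
    calc ‖f y - f x - ((y - x : ℝ) : ℂ) * deriv f x‖
        = ‖f y - (y : ℂ) * deriv f x - (f x - (x : ℂ) * deriv f x)‖ := by
          congr 1; push_cast; ring
      _ ≤ M * |y - x| * |y - x| := h
      _ = _ := by ring
  · rw [(hd z).deriv, one_mul]
    exact (hlip z x).trans (mul_le_mul_of_nonneg_left (abs_sub_left_of_mem_uIcc hz) hM0)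

end Taylor

lemma abs_posPart_sub_le (x y : ℝ) : |max x 0 - max y 0| ≤ |x - y| := by
  simpa using abs_max_sub_max_le_max x 0 y 0

lemma norm_secondDiff_le {v : ℝ → ℂ} {C : ℝ} {t x : ℝ} (h0 : ‖v x‖ ≤ C) (h1 : ‖v (x + t)‖ ≤ C)
    (h2 : ‖v (x - t)‖ ≤ C) : ‖secondDiff v t x‖ ≤ 4 * C := by
  have e0 : ‖(2 : ℂ) * v x‖ = 2 * ‖v x‖ := by rw [norm_mul]; norm_num
  have e1 := norm_sub_le (2 * v x - v (x + t)) (v (x - t))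
  have e2 := norm_sub_le (2 * v x) (v (x + t))
  rw [secondDiff]
  linarith

/-- A smooth function of `x₊` pairs like `log |x|`, up to a continuous function. -/
lemma exists_hasPairing_comp_posPart {f : ℝ → ℂ} (hf : ContDiff ℝ ∞ f)
    (hc : HasCompactSupport (deriv f)) {C : ℝ} (hC : ∀ x, ‖f x‖ ≤ C) :
    ∃ g : ℝ → ℂ, Continuous g ∧ ∀ ψ : 𝓢(ℝ, ℂ), HasCompactSupport ψ →
      HasPairing (Ioi 0) (fun x => f (max x 0)) ψ (deriv f 0 * logAbs ψ + ∫ x, ψ x * g x) := by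
  obtain ⟨L, M, hL0, hM0, hL, hM, -, hT⟩ := exists_norm_le_of_hasCompactSupport_deriv hf hc
  have hfc := hf.continuous
  -- Subtracting the model f'(0)x₊ removes the kink at 0; the second differences of v are then
  -- O(t²), uniformly in x.
  set v : ℝ → ℂ := fun x => f (max x 0) - deriv f 0 * ((max x 0 : ℝ) : ℂ)
  have hvc : Continuous v := by fun_prop
  have hnear : ∀ x, ∀ t ∈ Ioc (0 : ℝ) 1, ‖secondDiff v t x / (t : ℂ) ^ 2‖ ≤ 3 * M := by
    intro x t ht
    have ht0 := ht.1
    set p := max x 0 with hp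
    have h1 := hT p (max (x + t) 0)
    have h2 := hT p (max (x - t) 0)
    have a1 : |max (x + t) 0 - p| ≤ t := by
      simpa [abs_of_pos ht0] using abs_posPart_sub_le (x + t) x
    have a2 : |max (x - t) 0 - p| ≤ t := by
      simpa [abs_of_pos ht0] using abs_posPart_sub_le (x - t) x
    have b1 : M * |max (x + t) 0 - p| ^ 2 ≤ M * t ^ 2 := by gcongr
    have b2 : M * |max (x - t) 0 - p| ^ 2 ≤ M * t ^ 2 := by gcongr
    have h3 := secondDiff_posPart ht0.le x
    have h4 : ‖(deriv f p - deriv f 0) * ((-max (t - |x|) 0 : ℝ) : ℂ)‖ ≤ M * t ^ 2 := by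
      rw [norm_mul, Complex.norm_real, norm_neg, Real.norm_of_nonneg (le_max_right _ _)]
      have h5 : ‖deriv f p - deriv f 0‖ ≤ M * |x| := by
        refine (hM p 0).trans (mul_le_mul_of_nonneg_left ?_ hM0)
        simpa [hp] using abs_posPart_sub_le x 0
      rcases le_total t |x| with h | h
      · rw [max_eq_right (by linarith), mul_zero]
        positivity
      · calc ‖deriv f p - deriv f 0‖ * max (t - |x|) 0 ≤ (M * t) * t := by
              gcongr
              · exact h5.trans (by gcongr)
              · exact max_le (by linarith [abs_nonneg x]) ht0.le
          _ = _ := by ring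
    -- Taylor expansion at p = x₊. The first-order terms combine to f'(p) - f'(0) times the tent -(t
    -- - |x|)₊; the coefficient is at most M|x| and the tent lives on |x| < t, so the product is at
    -- most Mt².
    have key : secondDiff v t x =
        -(f (max (x + t) 0) - f p - ((max (x + t) 0 - p : ℝ) : ℂ) * deriv f p)
          - (f (max (x - t) 0) - f p - ((max (x - t) 0 - p : ℝ) : ℂ) * deriv f p)
          + (deriv f p - deriv f 0) * ((-max (t - |x|) 0 : ℝ) : ℂ) := by
      rw [← h3]
      simp only [secondDiff, v, ← hp]
      push_cast
      ring
    have ht2 : ‖(t : ℂ) ^ 2‖ = t ^ 2 := by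
      rw [norm_pow, Complex.norm_real, Real.norm_of_nonneg ht0.le]
    rw [norm_div, ht2, div_le_iff₀ (by positivity), key]
    refine (norm_add_le _ _).trans ?_
    refine (add_le_add_left (norm_sub_le _ _) _).trans ?_
    rw [norm_neg]
    linarith
  obtain ⟨g₁, hg₁, H₁⟩ := exists_continuous_hasPairing (T := Ioc 0 1) measurableSet_Ioc hvc
    fun R => ⟨fun _ => 3 * M, continuous_const.integrableOn_Ioc, fun x _ => hnear x⟩
  -- For t > 1 the unsubtracted f(x₊) is used: it is bounded, whereas the model x₊ would diverge.
  obtain ⟨g₂, hg₂, H₂⟩ := exists_continuous_hasPairing (T := Ioi 1) measurableSet_Ioi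
    (v := fun x => f (max x 0)) (by fun_prop)
    fun R => ⟨fun t => 4 * C * (t ^ 2)⁻¹, (integral_inv_sq_Ioi one_pos).1.const_mul _,
      fun x _ t ht => by
        have ht0 : 0 < t := one_pos.trans ht
        rw [norm_div, norm_pow, Complex.norm_real, Real.norm_of_nonneg ht0.le, div_eq_mul_inv]
        exact mul_le_mul_of_nonneg_right (norm_secondDiff_le (hC _) (hC _) (hC _))
          (by positivity)⟩
  refine ⟨fun x => g₁ x + g₂ x + deriv f 0 * ((logCorrection x : ℝ) : ℂ),
    (hg₁.add hg₂).add (continuous_const.mul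
      (Complex.continuous_ofReal.comp continuous_logCorrection)), fun ψ hψ => ?_⟩
  have hint : ∀ {w : ℝ → ℂ}, Continuous w → Integrable fun x => ψ x * w x := fun hw =>
    hw.locallyIntegrable.integrable_smul_left_of_hasCompactSupport ψ.continuous hψ
  have hpos : Continuous fun x : ℝ => deriv f 0 * ((max x 0 : ℝ) : ℂ) := by fun_prop
  have hA := (H₁ ψ ψ.continuous hψ).add hvc.locallyIntegrable hpos.locallyIntegrable
    ψ.continuous hψ ((hasPairing_posPart ψ hψ).const_mul (deriv f 0))
  have he : (fun x => v x + deriv f 0 * ((max x 0 : ℝ) : ℂ)) = fun x => f (max x 0) := by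
    funext x
    simp only [v]
    ring
  rw [he] at hA
  have hB := hA.union (Ioc_disjoint_Ioi le_rfl) measurableSet_Ioi (H₂ ψ ψ.continuous hψ)
  rw [Ioc_union_Ioi_eq_Ioi zero_le_one] at hB
  convert hB using 1
  have hlc : Continuous fun x : ℝ => ((logCorrection x : ℝ) : ℂ) :=
    Complex.continuous_ofReal.comp continuous_logCorrection
  have e1 : ∫ x, ψ x * (g₁ x + g₂ x + deriv f 0 * ((logCorrection x : ℝ) : ℂ)) =
      (∫ x, ψ x * g₁ x) + (∫ x, ψ x * g₂ x) +
        deriv f 0 * ∫ x, ψ x * ((logCorrection x : ℝ) : ℂ) := by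
    have h12 : Integrable fun x => ψ x * g₁ x + ψ x * g₂ x := (hint hg₁).add (hint hg₂)
    rw [← integral_const_mul, ← integral_add (hint hg₁) (hint hg₂),
      ← integral_add h12 ((hint hlc).const_mul _)]
    refine integral_congr_ae (Eventually.of_forall fun x => ?_)
    simp only
    ring
  rw [e1]
  ring

lemma abs_sqrt_sub_sqrt_le (a b : ℝ) : |√a - √b| ≤ √|a - b| := by
  have key : ∀ a b : ℝ, √a - √b ≤ √|a - b| := fun a b => by
    have h1 : b ≤ √b ^ 2 := by
      rcases le_total b 0 with h | h
      · exact h.trans (sq_nonneg _)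
      · rw [Real.sq_sqrt h]
    have h2 : √|a - b| ^ 2 = |a - b| := Real.sq_sqrt (abs_nonneg _)
    have h3 : √a ≤ √b + √|a - b| := by
      refine Real.sqrt_le_iff.2 ⟨by positivity, ?_⟩
      nlinarith [le_abs_self (a - b), mul_nonneg (Real.sqrt_nonneg b) (Real.sqrt_nonneg |a - b|)]
    linarith
  refine abs_le.2 ⟨?_, key a b⟩
  have := key b a
  rw [abs_sub_comm] at this
  linarith

/-- For x ≥ t the second difference is of order t²x^{-3/2}, and the factor x lowers this to
t²x^{-1/2} ≤ t^{3/2}. For |x| ≤ t the Hölder bound suffices, and for x ≤ -t everything vanishes. A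
factor f with f(0) = 0 supplies the needed |x|. -/
lemma abs_mul_abs_sqrtSecondDiff_le {t : ℝ} (ht : 0 < t) (x : ℝ) :
    |x| * |sqrtSecondDiff t x| ≤ 2 * (t * √t) := by
  have htt : √t * √t = t := Real.mul_self_sqrt ht.le
  have hst : 0 < √t := Real.sqrt_pos.2 ht
  rcases le_total |x| t with h | h
  · have h1 := abs_sqrt_sub_sqrt_le x (x + t)
    have h2 := abs_sqrt_sub_sqrt_le x (x - t)
    rw [show x - (x + t) = -t by ring, abs_neg, abs_of_pos ht] at h1
    rw [show x - (x - t) = t by ring, abs_of_pos ht] at h2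
    have h3 : |sqrtSecondDiff t x| ≤ 2 * √t := by
      rw [sqrtSecondDiff, show 2 * √x - √(x + t) - √(x - t) =
        (√x - √(x + t)) + (√x - √(x - t)) by ring]
      exact (abs_add_le _ _).trans (by linarith)
    calc |x| * |sqrtSecondDiff t x| ≤ t * (2 * √t) := by gcongr
      _ = _ := by ring
  rcases le_total x 0 with hx | hx
  · rw [abs_of_nonpos hx] at h
    rw [sqrtSecondDiff, Real.sqrt_eq_zero_of_nonpos hx, Real.sqrt_eq_zero_of_nonpos (by linarith),
      Real.sqrt_eq_zero_of_nonpos (by linarith)]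
    simp only [mul_zero, sub_zero, abs_zero]
    positivity
  · rw [abs_of_nonneg hx] at h ⊢
    have hx0 : 0 < x := ht.trans_le h
    rw [sqrtSecondDiff]
    have hq : √x ^ 2 = x := Real.sq_sqrt hx
    have hr : √(x + t) ^ 2 = x + t := Real.sq_sqrt (by linarith)
    have hs : √(x - t) ^ 2 = x - t := Real.sq_sqrt (by linarith)
    have hqr : √x ≤ √(x + t) := Real.sqrt_le_sqrt (by linarith)
    have htq : √t ≤ √x := Real.sqrt_le_sqrt h
    have hsr : √(x - t) ≤ √(x + t) := Real.sqrt_le_sqrt (by linarith)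
    have hq0 : 0 < √x := Real.sqrt_pos.2 hx0
    have hs0 : 0 ≤ √(x - t) := Real.sqrt_nonneg _
    generalize √x = q at *
    generalize √(x + t) = r at *
    generalize √(x - t) = s at *
    -- Multiplying by the conjugate and using 2q² = r² + s² turns the second difference into the
    -- square of a first difference, and r - s = 2t/(r + s) ≤ 2t/q.
    have hid : (2 * q - r - s) * (2 * q + r + s) = (r - s) ^ 2 := by
      linear_combination 4 * hq - 2 * hr - 2 * hs
    have hrs : (r - s) * (r + s) = 2 * t := by linear_combination hr - hs
    have hd : (r - s) * q ≤ 2 * t := by nlinarith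
    have hnn : 0 ≤ 2 * q - r - s := by
      by_contra hneg
      push Not at hneg
      nlinarith [sq_nonneg (r - s), mul_pos (neg_pos.2 hneg) (show 0 < 2 * q + r + s by linarith)]
    rw [abs_of_nonneg hnn]
    have h1 : (2 * q - r - s) * (2 * q) ≤ (r - s) ^ 2 := by
      rw [← hid]
      exact mul_le_mul_of_nonneg_left (by linarith) hnn
    have h2 : (2 * q - r - s) * (2 * q) * q ^ 2 ≤ (2 * t) ^ 2 := by
      calc (2 * q - r - s) * (2 * q) * q ^ 2 ≤ (r - s) ^ 2 * q ^ 2 := by gcongr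
        _ = ((r - s) * q) ^ 2 := by ring
        _ ≤ (2 * t) ^ 2 := by
          have : 0 ≤ (r - s) * q := mul_nonneg (by linarith) hq0.le
          gcongr
    have h3 : x * (2 * q - r - s) * q ≤ 2 * t ^ 2 := by
      rw [← hq]
      linarith
    have h4 : x * (2 * q - r - s) * √t ≤ 2 * t ^ 2 :=
      (mul_le_mul_of_nonneg_left htq (by positivity)).trans h3
    have h5 : x * (2 * q - r - s) * √t ≤ 2 * (t * √t) * √t := by
      refine h4.trans_eq ?_
      linear_combination -2 * t * htt
    exact le_of_mul_le_mul_right h5 hst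

/-- If the smooth function `f` vanishes at `0`, then `f(x) x₊^{1/2}` pairs like a continuous
function. -/
lemma exists_hasPairing_mul_sqrt {f : ℝ → ℂ} (hf : ContDiff ℝ ∞ f)
    (hc : HasCompactSupport (deriv f)) {C : ℝ} (hC : ∀ x, ‖f x‖ ≤ C) (hf0 : f 0 = 0) :
    ∃ g : ℝ → ℂ, Continuous g ∧ ∀ ψ : 𝓢(ℝ, ℂ), HasCompactSupport ψ →
      HasPairing (Ioi 0) (fun x => f x * ((√x : ℝ) : ℂ)) ψ (∫ x, ψ x * g x) := by
  obtain ⟨L, M, hL0, hM0, hL, -, hLip, hT⟩ := exists_norm_le_of_hasCompactSupport_deriv hf hc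
  have hfc := hf.continuous
  have hC0 : 0 ≤ C := (norm_nonneg _).trans (hC 0)
  set v : ℝ → ℂ := fun x => f x * ((√x : ℝ) : ℂ)
  have hvc : Continuous v := by fun_prop
  have hnt : ∀ {t : ℝ}, 0 < t → ‖(t : ℂ) ^ 2‖ = t ^ 2 := fun ht => by
    rw [norm_pow, Complex.norm_real, Real.norm_of_nonneg ht.le]
  have hnear : ∀ R x, |x| ≤ R → ∀ t ∈ Ioc (0 : ℝ) 1, ‖secondDiff v t x / (t : ℂ) ^ 2‖ ≤
      (4 * L + 2 * M * √(R + 1)) * t ^ (-(1 / 2) : ℝ) := by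
    intro R x hx t ht
    have ht0 := ht.1
    have htt : √t * √t = t := Real.mul_self_sqrt ht0.le
    have hx' := abs_le.1 hx
    have hle : t ^ 2 ≤ t * √t := by
      have h1 : √t ≤ 1 := Real.sqrt_le_one.2 ht.2
      have h2 : t ≤ √t := by nlinarith [Real.sqrt_nonneg t]
      nlinarith
    have hw1 : √(x + t) ≤ √(R + 1) := Real.sqrt_le_sqrt (by linarith [ht.2])
    have hw2 : √(x - t) ≤ √(R + 1) := Real.sqrt_le_sqrt (by linarith [ht.2])
    have hw3 : |√(x + t) - √(x - t)| ≤ 2 * √t := by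
      have h1 := abs_sqrt_sub_sqrt_le (x + t) x
      have h2 := abs_sqrt_sub_sqrt_le x (x - t)
      rw [show x + t - x = t by ring, abs_of_pos ht0] at h1
      rw [show x - (x - t) = t by ring, abs_of_pos ht0] at h2
      calc |√(x + t) - √(x - t)| ≤ |√(x + t) - √x| + |√x - √(x - t)| := abs_sub_le _ _ _
        _ ≤ _ := by linarith
    have h1 := hT x (x + t)
    have h2 := hT x (x - t)
    rw [show x + t - x = t by ring, abs_of_pos ht0] at h1
    rw [show x - t - x = -t by ring, abs_neg, abs_of_pos ht0] at h2
    -- Leibniz rule for second differences. The four terms are O(t^{3/2}): the first by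
    -- `abs_mul_abs_sqrtSecondDiff_le`, the second by the Hölder bound for the root, and the Taylor
    -- remainders since t² ≤ t√t. They contribute 2L, 2L and twice M√(R + 1) to the constant.
    have key : secondDiff v t x = f x * ((sqrtSecondDiff t x : ℝ) : ℂ)
        - t * deriv f x * ((√(x + t) - √(x - t) : ℝ) : ℂ)
        - (f (x + t) - f x - (t : ℂ) * deriv f x) * ((√(x + t) : ℝ) : ℂ)
        - (f (x - t) - f x - ((-t : ℝ) : ℂ) * deriv f x) * ((√(x - t) : ℝ) : ℂ) := by
      simp only [secondDiff, sqrtSecondDiff, v]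
      push_cast
      ring
    have n1 : ‖f x * ((sqrtSecondDiff t x : ℝ) : ℂ)‖ ≤ L * (2 * (t * √t)) := by
      rw [norm_mul, Complex.norm_real, Real.norm_eq_abs]
      have h3 := hLip x 0
      rw [hf0, sub_zero, sub_zero] at h3
      calc ‖f x‖ * |sqrtSecondDiff t x| ≤ L * |x| * |sqrtSecondDiff t x| := by gcongr
        _ = L * (|x| * |sqrtSecondDiff t x|) := by ring
        _ ≤ _ := mul_le_mul_of_nonneg_left (abs_mul_abs_sqrtSecondDiff_le ht0 x) hL0
    have n2 : ‖t * deriv f x * ((√(x + t) - √(x - t) : ℝ) : ℂ)‖ ≤ t * L * (2 * √t) := by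
      rw [norm_mul, norm_mul, Complex.norm_real, Complex.norm_real, Real.norm_of_nonneg ht0.le,
        Real.norm_eq_abs]
      gcongr
      exact hL x
    have n3 : ‖(f (x + t) - f x - (t : ℂ) * deriv f x) * ((√(x + t) : ℝ) : ℂ)‖ ≤
        M * (t * √t) * √(R + 1) := by
      rw [norm_mul, Complex.norm_real, Real.norm_of_nonneg (Real.sqrt_nonneg _)]
      gcongr
      exact h1.trans (by gcongr)
    have n4 : ‖(f (x - t) - f x - ((-t : ℝ) : ℂ) * deriv f x) * ((√(x - t) : ℝ) : ℂ)‖ ≤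
        M * (t * √t) * √(R + 1) := by
      rw [norm_mul, Complex.norm_real, Real.norm_of_nonneg (Real.sqrt_nonneg _)]
      gcongr
      exact h2.trans (by gcongr)
    have he : t ^ (-(1 / 2) : ℝ) * t ^ 2 = t * √t := by
      rw [Real.sqrt_eq_rpow, ← Real.rpow_natCast t 2, ← Real.rpow_add ht0, ← Real.rpow_one_add' ht0.le
        (by norm_num)]
      norm_num
    rw [norm_div, hnt ht0, div_le_iff₀ (by positivity), mul_assoc _ _ (t ^ 2), he, key]
    refine (norm_sub_le _ _).trans ?_
    refine (add_le_add_left ((norm_sub_le _ _).trans (add_le_add_left (norm_sub_le _ _) _)) _).trans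
      ?_
    linarith
  have hfar : ∀ R x, |x| ≤ R → ∀ t ∈ Ioi (1 : ℝ), ‖secondDiff v t x / (t : ℂ) ^ 2‖ ≤
      4 * (C * √(R + 1)) * t ^ (-(3 / 2) : ℝ) := by
    intro R x hx t ht
    have ht1 : 1 < t := ht
    have ht0 : 0 < t := one_pos.trans ht1
    have hx' := abs_le.1 hx
    have hR : 0 ≤ R := (abs_nonneg x).trans hx
    -- For t > 1 and |x| ≤ R the points x and x ± t are at most (R + 1)t, so the growth √t of v
    -- leaves the integrable weight t^{-3/2}.
    have hv : ∀ y, y ≤ (R + 1) * t → ‖v y‖ ≤ C * √(R + 1) * √t := fun y hy => by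
      simp only [v]
      rw [norm_mul, Complex.norm_real, Real.norm_of_nonneg (Real.sqrt_nonneg _), mul_assoc,
        ← Real.sqrt_mul (by linarith)]
      exact mul_le_mul (hC y) (Real.sqrt_le_sqrt hy) (Real.sqrt_nonneg _) hC0
    have he : t ^ (-(3 / 2) : ℝ) * t ^ 2 = √t := by
      rw [Real.sqrt_eq_rpow, ← Real.rpow_natCast t 2, ← Real.rpow_add ht0]
      norm_num
    have hRt : R ≤ R * t := le_mul_of_one_le_right hR ht1.le
    rw [norm_div, hnt ht0, div_le_iff₀ (by positivity), mul_assoc _ _ (t ^ 2), he, mul_assoc]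
    exact norm_secondDiff_le (hv _ (by linarith)) (hv _ (by linarith)) (hv _ (by linarith))
  obtain ⟨g₁, hg₁, H₁⟩ := exists_continuous_hasPairing (T := Ioc 0 1) measurableSet_Ioc hvc
    fun R => ⟨_, ((intervalIntegrable_iff_integrableOn_Ioc_of_le zero_le_one).1
      (intervalIntegral.intervalIntegrable_rpow' (by norm_num))).const_mul _, hnear R⟩
  obtain ⟨g₂, hg₂, H₂⟩ := exists_continuous_hasPairing (T := Ioi 1) measurableSet_Ioi hvc
    fun R => ⟨_, (integrableOn_Ioi_rpow_of_lt (by norm_num) one_pos).const_mul _, hfar R⟩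
  refine ⟨fun x => g₁ x + g₂ x, hg₁.add hg₂, fun ψ hψ => ?_⟩
  have hint : ∀ {w : ℝ → ℂ}, Continuous w → Integrable fun x => ψ x * w x := fun hw =>
    hw.locallyIntegrable.integrable_smul_left_of_hasCompactSupport ψ.continuous hψ
  have hB := (H₁ ψ ψ.continuous hψ).union (Ioc_disjoint_Ioi le_rfl) measurableSet_Ioi
    (H₂ ψ ψ.continuous hψ)
  rw [Ioc_union_Ioi_eq_Ioi zero_le_one, ← integral_add (hint hg₁) (hint hg₂)] at hB
  simpa only [mul_add] using hB

/-! ### The expansions -/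

/-- The integral of the averages has a single value, so the hypothesis and `hasPairing_calH` can be
equated; the continuous remainder is g/(4π²). -/
lemma eqModC0_of_hasPairing {u : ℝ → ℂ} (hu : Integrable u) {S : 𝓢'(ℝ, ℂ)} {g : ℝ → ℂ}
    (hg : Continuous g) (h : ∀ ψ : 𝓢(ℝ, ℂ), HasCompactSupport ψ →
      HasPairing (Ioi 0) u ψ (((4 * Real.pi ^ 2 : ℝ) : ℂ) * S ψ + ∫ x, ψ x * g x)) :
    EqModC0 (calH u) S := by
  refine ⟨fun x => ((4 * Real.pi ^ 2 : ℝ) : ℂ)⁻¹ * g x, by fun_prop, fun ψ hψ => ?_⟩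
  have h1 := (hasPairing_calH hu ψ).integral_eq.symm.trans (h ψ hψ).integral_eq
  have h0 : ((4 * Real.pi ^ 2 : ℝ) : ℂ) ≠ 0 := Complex.ofReal_ne_zero.2 (by positivity)
  have h2 : ∫ x, ψ x * (((4 * Real.pi ^ 2 : ℝ) : ℂ)⁻¹ * g x) =
      ((4 * Real.pi ^ 2 : ℝ) : ℂ)⁻¹ * ∫ x, ψ x * g x := by
    rw [← integral_const_mul]
    refine integral_congr_ae (Eventually.of_forall fun x => ?_)
    simp only
    ring
  rw [h2, eq_inv_mul_iff_mul_eq₀ h0, mul_sub, h1]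
  ring

section Expansions

variable {φ : ℝ → ℂ}

lemma eqModC0_calH_mul_heaviside (hφ : ContDiff ℝ ∞ φ) (hc : HasCompactSupport φ) :
    EqModC0 (calH fun x => φ x * (heaviside x : ℂ))
      (((1 / (4 * Real.pi ^ 2) : ℝ) : ℂ) • (φ 0 • pvInv + deriv φ 0 • logAbs)) := by
  -- Since f(0) = 0, f(x₊) vanishes for x < 0, which gives φh₀ = φ(0)h₀ + f(x₊).
  set f : ℝ → ℂ := fun x => φ x - φ 0
  have hf : ContDiff ℝ ∞ f := hφ.sub contDiff_const
  have hd : deriv f = deriv φ := funext fun x => deriv_sub_const _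
  obtain ⟨C, hC⟩ := hc.exists_bound_of_continuous hφ.continuous
  obtain ⟨g, hg, H⟩ := exists_hasPairing_comp_posPart hf (hd ▸ hc.deriv) (C := C + ‖φ 0‖)
    fun x => (norm_sub_le _ _).trans (add_le_add_left (hC x) _)
  refine eqModC0_of_hasPairing (integrable_cutoff hφ.continuous hc locallyIntegrable_heaviside) hg
    fun ψ hψ => ?_
  have hl : LocallyIntegrable fun x => φ 0 * (heaviside x : ℂ) := fun x =>
    ((locallyIntegrable_heaviside x).imp fun _ h => ⟨h.1, (h.2.ofReal (𝕜 := ℂ)).const_mul _⟩)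
  have hfc : Continuous fun x => f (max x 0) := hf.continuous.comp (by fun_prop)
  have h := ((hasPairing_heaviside ψ hψ).const_mul (φ 0)).add hl hfc.locallyIntegrable
    ψ.continuous hψ (H ψ hψ)
  convert h using 1
  · funext x
    simp only [f, heaviside]
    split_ifs with hx
    · rw [max_eq_left hx]
      push_cast
      ring
    · rw [max_eq_right (not_le.1 hx).le]
      simp
  · have hp : (Real.pi : ℂ) ≠ 0 := Complex.ofReal_ne_zero.2 Real.pi_ne_zero
    have : (((1 / (4 * Real.pi ^ 2) : ℝ) : ℂ) • (φ 0 • pvInv + deriv φ 0 • logAbs)) ψ =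
        ((1 / (4 * Real.pi ^ 2) : ℝ) : ℂ) * (φ 0 * pvInv ψ + deriv φ 0 * logAbs ψ) := rfl
    rw [this, hd]
    push_cast
    field_simp
    ring

lemma eqModC0_calH_mul_posPart (hφ : ContDiff ℝ ∞ φ) (hc : HasCompactSupport φ) :
    EqModC0 (calH fun x => φ x * ((max x 0 : ℝ) : ℂ))
      ((((1 / (4 * Real.pi ^ 2) : ℝ) : ℂ) * φ 0) • logAbs) := by
  -- Here φx₊ is exactly f(x₊), and f'(0) = φ(0) is the coefficient of the logarithm.
  set f : ℝ → ℂ := fun x => φ x * (x : ℂ)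
  have hf : ContDiff ℝ ∞ f := hφ.mul Complex.ofRealCLM.contDiff
  have hcf : HasCompactSupport f := hc.mul_right
  have hd : deriv f 0 = φ 0 := by
    have h := ((hφ.differentiable (by simp) 0).hasDerivAt).mul (Complex.ofRealCLM.hasDerivAt (x := 0))
    simpa using! h.deriv
  obtain ⟨C, hC⟩ := hcf.exists_bound_of_continuous hf.continuous
  obtain ⟨g, hg, H⟩ := exists_hasPairing_comp_posPart hf hcf.deriv hC
  refine eqModC0_of_hasPairing (integrable_cutoff hφ.continuous hc locallyIntegrable_posPart) hg
    fun ψ hψ => ?_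
  convert H ψ hψ using 1
  · funext x
    simp only [f]
    rcases le_total x 0 with hx | hx
    · rw [max_eq_right hx]
      simp
    · rw [max_eq_left hx]
  · have hp : (Real.pi : ℂ) ≠ 0 := Complex.ofReal_ne_zero.2 Real.pi_ne_zero
    have : ((((1 / (4 * Real.pi ^ 2) : ℝ) : ℂ) * φ 0) • logAbs) ψ =
        ((1 / (4 * Real.pi ^ 2) : ℝ) : ℂ) * φ 0 * logAbs ψ := rfl
    rw [this, hd]
    push_cast
    field_simp

lemma eqModC0_calH_mul_posPart_sqrt (hφ : ContDiff ℝ ∞ φ) (hc : HasCompactSupport φ) :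
    EqModC0 (calH fun x => φ x * (((max x 0) ^ (1 / 2 : ℝ) : ℝ) : ℂ))
      ((-((1 / (8 * Real.pi) : ℝ) : ℂ) * φ 0) • negPartInvSqrt) := by
  set f : ℝ → ℂ := fun x => φ x - φ 0
  have hf : ContDiff ℝ ∞ f := hφ.sub contDiff_const
  have hd : deriv f = deriv φ := funext fun x => deriv_sub_const _
  obtain ⟨C, hC⟩ := hc.exists_bound_of_continuous hφ.continuous
  obtain ⟨g, hg, H⟩ := exists_hasPairing_mul_sqrt hf (hd ▸ hc.deriv) (C := C + ‖φ 0‖)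
    (fun x => (norm_sub_le _ _).trans (add_le_add_left (hC x) _)) (sub_self _)
  refine eqModC0_of_hasPairing
    (integrable_cutoff hφ.continuous hc locallyIntegrable_posPart_sqrt) hg fun ψ hψ => ?_
  have h1 : Continuous fun x : ℝ => φ 0 * ((√x : ℝ) : ℂ) := by fun_prop
  have h2 : Continuous fun x : ℝ => f x * ((√x : ℝ) : ℂ) := by
    have := hf.continuous
    fun_prop
  have h := ((hasPairing_sqrt ψ hψ).const_mul (φ 0)).add h1.locallyIntegrable
    h2.locallyIntegrable ψ.continuous hψ (H ψ hψ)
  convert h using 1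
  · funext x
    have hx : (max x 0) ^ (1 / 2 : ℝ) = √x := by
      rw [← Real.sqrt_eq_rpow]
      rcases le_total x 0 with hx | hx
      · rw [max_eq_right hx, Real.sqrt_zero, Real.sqrt_eq_zero_of_nonpos hx]
      · rw [max_eq_left hx]
    simp only [f]
    rw [hx]
    ring
  -- The constant is -(π/2)/(4π²) = -1/(8π).
  · have hp : (Real.pi : ℂ) ≠ 0 := Complex.ofReal_ne_zero.2 Real.pi_ne_zero
    have : ((-((1 / (8 * Real.pi) : ℝ) : ℂ) * φ 0) • negPartInvSqrt) ψ =
        -((1 / (8 * Real.pi) : ℝ) : ℂ) * φ 0 * negPartInvSqrt ψ := rfl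
    rw [this]
    push_cast
    field_simp
    ring

end Expansions

end SingH

theorem lemma6p1 (φ : ℝ → ℂ) (hφ : ContDiff ℝ ∞ φ) (hc : HasCompactSupport φ) :
    SingH.EqModC0 (SingH.calH fun x => φ x * (SingH.heaviside x : ℂ))
      (((1 / (4 * Real.pi ^ 2) : ℝ) : ℂ) •
        (φ 0 • SingH.pvInv + deriv φ 0 • SingH.logAbs)) ∧
    SingH.EqModC0 (SingH.calH fun x => φ x * ((max x 0 : ℝ) : ℂ))
      ((((1 / (4 * Real.pi ^ 2) : ℝ) : ℂ) * φ 0) • SingH.logAbs) ∧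
    SingH.EqModC0 (SingH.calH fun x => φ x * (((max x 0) ^ (1 / 2 : ℝ) : ℝ) : ℂ))
      ((-((1 / (8 * Real.pi) : ℝ) : ℂ) * φ 0) • SingH.negPartInvSqrt) :=
  ⟨SingH.eqModC0_calH_mul_heaviside hφ hc, SingH.eqModC0_calH_mul_posPart hφ hc,
    SingH.eqModC0_calH_mul_posPart_sqrt hφ hc⟩
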